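/- A mould is a family $P=(P(u_1,\ldots,u_r))_{r\ge 0}$ with $P(u_1,\ldots,u_r)\in\mathbb{Q}(u_1,\ldots,u_r)$. Let $ARI$ (resp. $GARI$) be the set of moulds with $P(\emptyset)=0$ (resp. $P(\emptyset)=1$). Put $(PQ)(u_1,\ldots,u_r)=\sum_{i=0}^r P(u_1,\ldots,u_i)Q(u_{i+1},\ldots,u_r)$ and $[P,Q]=PQ-QP$; $ARI_{lu}$ is the Lie algebra $ARI$ with this bracket, and $ad(P)\cdot Q=[P,Q]$. In depth $r\ge 1$ let $dar$, $dur$, $\Delta$ be multiplication by $u_1\cdots u_r$, by $u_1+\cdots+u_r$, and by $u_1\cdots u_r(u_1+\cdots+u_r)$ respectively; all three are the identity in depth $0$. For $P\in ARI$ let $$(arit(P)\cdot Q)({\bf u})=\sum_{{\bf u}={\bf abc},\,{\bf c}\neq\emptyset}Q({\bf a}\lceil{\bf c})P({\bf b})-\sum_{{\bf u}={\bf abc},\,{\bf a}\neq\emptyset}Q({\bf a}\rceil{\bf c})P({\bf b}),$$ where $\lceil{\bf c}$ (resp. ${\bf a}\rceil$) is the word ${\bf c}$ (resp. ${\bf a}$)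 with its first (resp. last) letter increased by the sum of the letters of ${\bf b}$. Put $preari(P,Q)=PQ+arit(Q)\cdot P$ and $ari(P,Q)=preari(P,Q)-preari(Q,P)$, and $$Darit(P)=-dar\circ\bigl(arit(\Delta^{-1}P)-ad(\Delta^{-1}P)\bigr)\circ dar^{-1}.$$ Let $exp_{ari}(P)=\sum_{n\ge 0}\frac{1}{n!}preari(P,\ldots,P)$ (with $n$ arguments, composed from left to right) and $exp_{Dari}(P)=1+\sum_{n\ge 1}\frac{1}{n!}Darit(P)^{n-1}(P)$; these are bijections $ARI\to GARI$, with inverses $log_{ari}$, $log_{Dari}$. For $Q\in GARI$ let $Dgarit(Q)=\exp\bigl(Darit(log_{Dari}(Q))\bigr)$, and let $\Delta^*=exp_{Dari}\circ\Delta\circ log_{ari}$. For $P,Q\in GARI$ let $P^{-1}$ be the inverse of $P$ for the product $PQ$ above, let $$(garit(P)\cdot Q)({\bf u})=\sum Q(\lceil{\bf b}_1\rceil\cdots\lceil{\bf b}_s\rceil)P({\bf a}_1)\cdots P({\bf a}_s)P^{-1}({\bf c}_1)\cdots P^{-1}({\bf c}_s),$$ the sum being over $s\ge 0$ and all cuttings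 ${\bf u}={\bf a}_1{\bf b}_1{\bf c}_1\cdots{\bf a}_s{\bf b}_s{\bf c}_s$ with all ${\bf b}_i\neq\emptyset$ and all ${\bf c}_i{\bf a}_{i+1}\neq\emptyset$, where $\lceil{\bf b}_i\rceil$ is ${\bf b}_i$ with its first letter increased by the sum of the letters of ${\bf a}_i$ and its last letter increased by the sum of the letters of ${\bf c}_i$; and let $gari(P,Q)=(garit(Q)\cdot P)\,Q$, which makes $GARI$ a group, with Lie algebra $(ARI,ari)$ and exponential map $exp_{ari}$. Its adjoint action on $ARI$ is $Ad_{ari}(P)=\exp\bigl(ad_{ari}(log_{ari}(P))\bigr)$, where $ad_{ari}(P)\cdot Q=ari(P,Q)$. Let $pal\in GARI$ be the mould with $dur(pal)=pal\cdot dupal$ in all depths $r\ge 1$, where, with the Bernoulli numbers $B_r$ ($B_1=-\frac12$), $dupal(\emptyset)=0$ and $$dupal(u_1,\ldots,u_r)=\frac{B_r}{r!}\,\frac{1}{u_1\cdots u_r}\sum_{j=0}^{r-1}(-1)^j\binom{r-1}{j}u_{j+1}\qquad(r\ge 1),$$ and let $invpal$ be the inverse of $pal$ in the group $(GARI,gari)$.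 **Proposition.** For every $F\in ARI$, the operators $Darit\bigl(\Delta(Ad_{ari}(invpal)\cdot F)\bigr)$ and $Darit(\Delta(F))$ are derivations of $ARI_{lu}$, the operator $Dgarit(\Delta^*(invpal))$ is an automorphism of $ARI_{lu}$, and $$Darit\bigl(\Delta(Ad_{ari}(invpal)\cdot F)\bigr)=Dgarit\bigl(\Delta^*(invpal)\bigr)\circ Darit\bigl(\Delta(F)\bigr)\circ Dgarit\bigl(\Delta^*(invpal)\bigr)^{-1}.$$ The same identity holds on the Lie algebra $ARI^a_{lu}=ARI_{lu}\oplus\mathbb{Q}a$, in which $[Q,a]=dur(Q)$ for $Q\in ARI$, when each derivation $Darit(P)$ is extended by $Darit(P)\cdot a=P$ and the automorphism $Dgarit(Q)$ by $Dgarit(Q)\cdot a=a-1+Q$. -/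

import Mathlib

open scoped BigOperators

namespace EcalleMould

/-- The field `ℚ(u₁, …, u_r)`. -/
def RatFun (r : ℕ) : Type := FractionRing (MvPolynomial (Fin r) ℚ)

noncomputable instance (r : ℕ) : Field (RatFun r) :=
  inferInstanceAs (Field (FractionRing (MvPolynomial (Fin r) ℚ)))
noncomputable instance (r : ℕ) : Algebra (MvPolynomial (Fin r) ℚ) (RatFun r) :=
  inferInstanceAs (Algebra (MvPolynomial (Fin r) ℚ) (FractionRing (MvPolynomial (Fin r) ℚ)))
noncomputable instance (r : ℕ) : Algebra ℚ (RatFun r) :=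
  inferInstanceAs (Algebra ℚ (FractionRing (MvPolynomial (Fin r) ℚ)))
instance (r : ℕ) : IsScalarTower ℚ (MvPolynomial (Fin r) ℚ) (RatFun r) :=
  IsScalarTower.of_algebraMap_eq' (Subsingleton.elim _ _)
instance (r : ℕ) : IsFractionRing (MvPolynomial (Fin r) ℚ) (RatFun r) :=
  inferInstanceAs (IsFractionRing (MvPolynomial (Fin r) ℚ)
    (FractionRing (MvPolynomial (Fin r) ℚ)))

/-- A mould: a rational function `P(u₁, …, u_r) ∈ ℚ(u₁, …, u_r)` for every depth `r ≥ 0`. -/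
def Mould : Type := ∀ r : ℕ, RatFun r

/-- The word `(u₁, …, u_r)` whose letters are the variables of `ℚ(u₁, …, u_r)`. -/
noncomputable def gen (r : ℕ) : List (RatFun r) :=
  List.ofFn fun i => algebraMap (MvPolynomial (Fin r) ℚ) (RatFun r) (MvPolynomial.X i)

/-- The value `f(v₁, …, v_s)` of a rational function at elements of a field extension of `ℚ`,
computed from the reduced fraction that represents `f`. -/
noncomputable def evalRat {s : ℕ} {L : Type*} [Field L] [Algebra ℚ L]
    (f : RatFun s) (v : Fin s → L) : L :=
  MvPolynomial.aeval v (IsFractionRing.num (MvPolynomial (Fin s) ℚ) f) /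
    MvPolynomial.aeval v (IsFractionRing.den (MvPolynomial (Fin s) ℚ) f : MvPolynomial (Fin s) ℚ)

namespace Mould

@[ext] theorem ext {P Q : Mould} (h : ∀ r, P r = Q r) : P = Q := funext h

/-- The value `P(w)` of a mould on a word `w` with letters in a field extension of `ℚ`. -/
noncomputable def eval {L : Type*} [Field L] [Algebra ℚ L] (P : Mould) (w : List L) : L :=
  evalRat (P w.length) w.get

noncomputable instance : AddCommGroup Mould := inferInstanceAs (AddCommGroup (∀ r, RatFun r))
noncomputable instance : Module ℚ Mould := inferInstanceAs (Module ℚ (∀ r, RatFun r))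

@[simp] theorem add_apply (P Q : Mould) (r : ℕ) : (P + Q) r = P r + Q r := rfl
@[simp] theorem sub_apply (P Q : Mould) (r : ℕ) : (P - Q) r = P r - Q r := rfl
@[simp] theorem neg_apply (P : Mould) (r : ℕ) : (-P) r = -P r := rfl
@[simp] theorem smul_apply (q : ℚ) (P : Mould) (r : ℕ) : (q • P) r = q • P r := rfl
@[simp] theorem zero_apply (r : ℕ) : (0 : Mould) r = 0 := rfl

/-- The unit mould: `1` in depth `0` and `0` in positive depth. -/
noncomputable instance : One Mould := ⟨fun r => if r = 0 then 1 else 0⟩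

/-- The mould product `mu`: `(P Q)(u₁, …, u_r) = ∑ᵢ P(u₁, …, u_i) Q(u_{i+1}, …, u_r)`. -/
noncomputable instance : Mul Mould := ⟨fun P Q r =>
  ∑ i ∈ Finset.range (r + 1), P.eval ((gen r).take i) * Q.eval ((gen r).drop i)⟩

theorem one_apply (r : ℕ) : (1 : Mould) r = if r = 0 then 1 else 0 := rfl

theorem mul_apply (P Q : Mould) (r : ℕ) : (P * Q) r =
    ∑ i ∈ Finset.range (r + 1), P.eval ((gen r).take i) * Q.eval ((gen r).drop i) := rfl

end Mould

/-! ### Evaluation at independent words -/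

section Evaluation

variable {L L' : Type*} [Field L] [Algebra ℚ L] [Field L'] [Algebra ℚ L']

/-- The letters of the word are algebraically independent over `ℚ`. -/
def Indep (w : List L) : Prop := AlgebraicIndependent ℚ w.get

theorem evalRat_map {s : ℕ} (φ : L →ₐ[ℚ] L') (f : RatFun s) (v : Fin s → L) :
    evalRat f (fun i => φ (v i)) = φ (evalRat f v) := by
  have h : ∀ p : MvPolynomial (Fin s) ℚ,
      MvPolynomial.aeval (fun i => φ (v i)) p = φ (MvPolynomial.aeval v p) := fun p => by
    have := MvPolynomial.comp_aeval_apply (f := v) φ p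
    rw [this]
  simp only [evalRat, h, map_div₀]

theorem evalRat_eq_lift {s : ℕ} {v : Fin s → L} (hv : AlgebraicIndependent ℚ v) (f : RatFun s) :
    evalRat f v = IsFractionRing.liftAlgHom (K := RatFun s)
      (algebraicIndependent_iff_injective_aeval.1 hv) f := by
  conv_rhs => rw [← IsFractionRing.mk'_num_den' (MvPolynomial (Fin s) ℚ) f]
  rw [map_div₀, IsFractionRing.liftAlgHom_apply, IsFractionRing.liftAlgHom_apply,
    IsFractionRing.lift_algebraMap, IsFractionRing.lift_algebraMap]
  rfl

theorem eval_eq_of_length {n : ℕ} (P : Mould) (w : List L) (h : w.length = n) :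
    P.eval w = evalRat (P n) (fun i => w.get (i.cast h.symm)) := by
  subst h; rfl

theorem eval_map (φ : L →ₐ[ℚ] L') (P : Mould) (w : List L) :
    P.eval (w.map φ) = φ (P.eval w) := by
  rw [eval_eq_of_length P (w.map φ) (by simp : _ = w.length), Mould.eval, ← evalRat_map]
  simp

/-- Evaluation at an independent word, as a homomorphism of fields. -/
noncomputable def evalHom {w : List L} (hw : Indep w) : RatFun w.length →ₐ[ℚ] L :=
  IsFractionRing.liftAlgHom (K := RatFun w.length)
    (algebraicIndependent_iff_injective_aeval.1 hw)

theorem eval_eq_evalHom {w : List L} (hw : Indep w) (P : Mould) :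
    P.eval w = evalHom hw (P w.length) := evalRat_eq_lift hw _

@[simp] theorem length_gen (r : ℕ) : (gen r).length = r := by simp [gen]

theorem map_gen {w : List L} (hw : Indep w) : (gen w.length).map (evalHom hw) = w := by
  apply List.ext_get
  · simp
  · intro n h1 h2
    simp only [gen, evalHom, List.get_eq_getElem, List.getElem_map, List.getElem_ofFn]
    rw [IsFractionRing.liftAlgHom_apply, IsFractionRing.lift_algebraMap]
    simp

theorem indep_gen (r : ℕ) : Indep (gen r) := by
  have h : AlgebraicIndependent ℚ
      (fun i : Fin r => algebraMap (MvPolynomial (Fin r) ℚ) (RatFun r) (MvPolynomial.X i)) :=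
    (MvPolynomial.algebraicIndependent_X (Fin r) ℚ).map'
      (f := IsScalarTower.toAlgHom ℚ (MvPolynomial (Fin r) ℚ) (RatFun r))
      (IsFractionRing.injective _ _)
  have h2 := h.comp (Fin.cast (length_gen r)) (Fin.cast_injective _)
  unfold Indep
  convert h2 using 1
  funext i
  change (gen r)[i.val]'i.isLt = _
  simp only [gen, List.getElem_ofFn]
  rfl

theorem Indep.sublist {w w' : List L} (hw : Indep w) (h : w'.Sublist w) : Indep w' := by
  obtain ⟨f, hf⟩ := List.sublist_iff_exists_fin_orderEmbedding_get_eq.1 h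
  have h2 := AlgebraicIndependent.comp hw f f.injective
  unfold Indep
  convert h2 using 1
  funext i
  exact hf i

theorem eval_gen (P : Mould) (r : ℕ) : P.eval (gen r) = P r := by
  have key : ∀ (n : ℕ) (v : Fin n → RatFun n)
      (_ : v = fun i => algebraMap (MvPolynomial (Fin n) ℚ) (RatFun n) (MvPolynomial.X i))
      (f : RatFun n), evalRat f v = f := by
    rintro n v rfl f
    have h : ∀ p : MvPolynomial (Fin n) ℚ, MvPolynomial.aeval (fun i =>
        algebraMap (MvPolynomial (Fin n) ℚ) (RatFun n) (MvPolynomial.X i)) p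
        = algebraMap _ (RatFun n) p := fun p => by
      have := MvPolynomial.comp_aeval_apply (f := (MvPolynomial.X : Fin n → MvPolynomial (Fin n) ℚ))
        (IsScalarTower.toAlgHom ℚ (MvPolynomial (Fin n) ℚ) (RatFun n)) p
      simpa using this.symm
    rw [evalRat, h, h, IsFractionRing.mk'_num_den']
  rw [eval_eq_of_length P _ (length_gen r)]
  apply key
  funext i
  simp only [gen, List.get_ofFn]
  rfl

theorem eval_one (w : List L) : (1 : Mould).eval w = if w = [] then 1 else 0 := by
  by_cases h : w = []
  · subst h
    have hi : Indep ([] : List L) := by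
      have : IsEmpty (Fin ([] : List L).length) := inferInstanceAs (IsEmpty (Fin 0))
      exact (algebraicIndependent_empty_type_iff (R := ℚ)).2 (algebraMap ℚ L).injective
    rw [eval_eq_evalHom hi]
    simp [Mould.one_apply]
  · have : w.length ≠ 0 := by simpa using h
    have h3 : IsFractionRing.num (MvPolynomial (Fin w.length) ℚ) (0 : RatFun w.length) = 0 :=
      IsFractionRing.num_zero
    simp [Mould.eval, Mould.one_apply, h, evalRat, h3]

theorem eval_zero (w : List L) : (0 : Mould).eval w = 0 := by
  have h3 : IsFractionRing.num (MvPolynomial (Fin w.length) ℚ) (0 : RatFun w.length) = 0 :=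
    IsFractionRing.num_zero
  simp [Mould.eval, evalRat, h3]

theorem eval_add {w : List L} (hw : Indep w) (P Q : Mould) :
    (P + Q).eval w = P.eval w + Q.eval w := by
  simp [eval_eq_evalHom hw]

theorem eval_smul {w : List L} (hw : Indep w) (q : ℚ) (P : Mould) :
    (q • P).eval w = q • P.eval w := by
  simp [eval_eq_evalHom hw]

theorem eval_mul {w : List L} (hw : Indep w) (P Q : Mould) : (P * Q).eval w =
    ∑ i ∈ Finset.range (w.length + 1), P.eval (w.take i) * Q.eval (w.drop i) := by
  rw [eval_eq_evalHom hw, Mould.mul_apply, map_sum]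
  refine Finset.sum_congr rfl fun i _ => ?_
  rw [map_mul, ← eval_map, ← eval_map, List.map_take, List.map_drop, map_gen]

end Evaluation

namespace Mould

theorem indep_take (r i : ℕ) : Indep ((gen r).take i) :=
  (indep_gen r).sublist (List.take_sublist _ _)

theorem indep_drop (r i : ℕ) : Indep ((gen r).drop i) :=
  (indep_gen r).sublist (List.drop_sublist _ _)

protected theorem mul_assoc (P Q R : Mould) : P * Q * R = P * (Q * R) := by
  ext r
  simp only [mul_apply, eval_mul (indep_take r _), eval_mul (indep_drop r _), Finset.sum_mul,
    Finset.mul_sum, Finset.sum_sigma']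
  refine Finset.sum_bij' (fun x _ => ⟨x.2, x.1 - x.2⟩) (fun x _ => ⟨x.1 + x.2, x.1⟩) ?_ ?_ ?_ ?_ ?_
  · rintro ⟨i, j⟩ h; simp at h ⊢; omega
  · rintro ⟨i, j⟩ h; simp at h ⊢; omega
  · rintro ⟨i, j⟩ h; simp at h ⊢; omega
  · rintro ⟨i, j⟩ h; simp
  · rintro ⟨i, j⟩ h
    simp at h
    have h1 : min j i = j := by omega
    have h2 : j + (i - j) = i := by omega
    simp only [List.take_take, List.drop_drop, h1, h2, List.drop_take, mul_assoc]

/-- Moulds form an associative algebra under `mu`. -/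
noncomputable instance : Ring Mould :=
  { (inferInstance : AddCommGroup Mould), (inferInstance : Mul Mould),
    (inferInstance : One Mould) with
    mul_assoc := Mould.mul_assoc
    left_distrib := fun P Q R => by
      ext r
      simp [mul_apply, eval_add (indep_drop r _), mul_add, Finset.sum_add_distrib]
    right_distrib := fun P Q R => by
      ext r
      simp [mul_apply, eval_add (indep_take r _), add_mul, Finset.sum_add_distrib]
    zero_mul := fun P => by ext r; simp [mul_apply, eval_zero]
    mul_zero := fun P => by ext r; simp [mul_apply, eval_zero]
    one_mul := fun P => by
      ext r
      rw [mul_apply, Finset.sum_eq_single_of_mem 0 (by simp)]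
      · simp [eval_one, eval_gen]
      · intro i hi h0
        have : (gen r).take i ≠ [] := by
          intro h
          have := congrArg List.length h
          simp at this hi; omega
        simp [eval_one, this]
    mul_one := fun P => by
      ext r
      rw [mul_apply, Finset.sum_eq_single_of_mem r (by simp)]
      · have h1 : (gen r).take r = gen r := List.take_of_length_le (by simp)
        have h2 : (gen r).drop r = [] := List.drop_of_length_le (by simp)
        simp [eval_one, eval_gen, h1, h2]
      · intro i hi h0
        have : (gen r).drop i ≠ [] := by
          intro h
          have := congrArg List.length h
          simp at this hi; omega
        simp [eval_one, this] }

noncomputable instance : Algebra ℚ Mould :=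
  Algebra.ofModule
    (fun q P Q => by
      ext r
      simp [mul_apply, eval_smul (indep_take r _), Finset.smul_sum])
    (fun q P Q => by
      ext r
      simp [mul_apply, eval_smul (indep_drop r _), Finset.smul_sum])

/-- The bracket `lu(P, Q) = P Q - Q P`. -/
noncomputable instance : LieRing Mould := LieRing.ofAssociativeRing
noncomputable instance : LieAlgebra ℚ Mould := LieAlgebra.ofAssociativeAlgebra

theorem lie_def (P Q : Mould) : ⁅P, Q⁆ = P * Q - Q * P := rfl

theorem mul_zero_depth (P Q : Mould) : (P * Q) 0 = P 0 * Q 0 := by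
  have h : (gen 0) = [] := List.length_eq_zero_iff.1 (length_gen 0)
  have h2 : ∀ R : Mould, R.eval ([] : List (RatFun 0)) = R 0 := fun R => by
    rw [← h, eval_gen]
  simp [mul_apply, h, h2]

/-- `ARI`, the moulds with `P(∅) = 0`, with the bracket `lu(P, Q) = P Q - Q P`. -/
noncomputable def ARI : LieSubalgebra ℚ Mould where
  carrier := {P | P 0 = 0}
  add_mem' := fun {P Q} hP hQ => by
    simp only [Set.mem_ofPred_eq] at *
    simp [hP, hQ]
  zero_mem' := rfl
  smul_mem' := fun q P hP => by
    simp only [Set.mem_ofPred_eq] at *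
    simp [hP]
  lie_mem' := fun {P Q} hP hQ => by
    change P 0 = 0 at hP
    change Q 0 = 0 at hQ
    change ⁅P, Q⁆ 0 = 0
    simp [lie_def, mul_zero_depth, hP, hQ]

theorem mem_ARI {P : Mould} : P ∈ ARI ↔ P 0 = 0 := Iff.rfl

/-- `GARI`, the moulds with `P(∅) = 1`. -/
def GARI : Set Mould := {P | P 0 = 1}

/-! ### The operators `dar`, `dur`, `Δ` and their inverses -/

/-- `u₁ + ⋯ + u_r` for `r ≥ 1`, and `1` for `r = 0`. -/
noncomputable def durFactor (r : ℕ) : RatFun r := if r = 0 then 1 else (gen r).sum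

/-- `dar(P)(u₁, …, u_r) = u₁ ⋯ u_r P(u₁, …, u_r)`. -/
noncomputable def dar (P : Mould) : Mould := fun r => (gen r).prod * P r

/-- Division by `u₁ ⋯ u_r` in depth `r`. -/
noncomputable def darInv (P : Mould) : Mould := fun r => (gen r).prod⁻¹ * P r

/-- `dur(P)(u₁, …, u_r) = (u₁ + ⋯ + u_r) P(u₁, …, u_r)`, and `dur(P)(∅) = P(∅)`. -/
noncomputable def dur (P : Mould) : Mould := fun r => durFactor r * P r

/-- `Δ(P)(u₁, …, u_r) = u₁ ⋯ u_r (u₁ + ⋯ + u_r) P(u₁, …, u_r)`, and `Δ(P)(∅) = P(∅)`. -/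
noncomputable def Delta (P : Mould) : Mould := fun r => (gen r).prod * durFactor r * P r

/-- Division by `u₁ ⋯ u_r (u₁ + ⋯ + u_r)` in depth `r ≥ 1`. -/
noncomputable def DeltaInv (P : Mould) : Mould :=
  fun r => ((gen r).prod * durFactor r)⁻¹ * P r

/-! ### `arit`, the `ari` bracket and its exponential -/

/-- Add `x` to the first letter of a word. -/
def addHead {α : Type*} [Add α] (x : α) : List α → List α
  | [] => []
  | y :: l => (x + y) :: l

/-- Add `x` to the last letter of a word. -/
def addLast {α : Type*} [Add α] (x : α) (l : List α) : List α := (addHead x l.reverse).reverse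

@[simp] theorem length_addHead {α : Type*} [Add α] (x : α) (l : List α) :
    (addHead x l).length = l.length := by cases l <;> rfl

@[simp] theorem length_addLast {α : Type*} [Add α] (x : α) (l : List α) :
    (addLast x l).length = l.length := by simp [addLast]

/-- `arit(F) · M`, evaluated on `u = (u₁, …, u_r)`, is
`∑_{u = abc, c ≠ ∅} M(a ⌈c) F(b) - ∑_{u = abc, a ≠ ∅} M(a⌉ c) F(b)`, where `⌈c` (resp. `a⌉`) is the
word `c` (resp. `a`) whose first (resp. last) letter is increased by the sum of the letters of `b`.
Here `ab` is the prefix of length `j` and `a` the prefix of length `i ≤ j`. -/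
noncomputable def arit (F M : Mould) : Mould := fun r =>
  ∑ j ∈ Finset.range (r + 1), ∑ i ∈ Finset.range (j + 1),
    let a := (gen r).take i
    let b := ((gen r).take j).drop i
    let c := (gen r).drop j
    (if c = [] then 0 else M.eval (a ++ addHead b.sum c) * F.eval b)
      - (if a = [] then 0 else M.eval (addLast b.sum a ++ c) * F.eval b)

/-- The pre-Lie law `preari(P, Q) = P Q + arit(Q) · P`. -/
noncomputable def preari (P Q : Mould) : Mould := P * Q + arit Q P

/-- The bracket `ari(P, Q) = arit(Q) · P - arit(P) · Q + [P, Q]`, that is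
`preari(P, Q) - preari(Q, P)`. -/
noncomputable def ari (P Q : Mould) : Mould := arit Q P - arit P Q + ⁅P, Q⁆

/-- The series `1 + ∑_{n ≥ 1} (1/n!) T^{n-1}(P)`, for an operator `T` that raises the depth: as
`P(∅) = 0`, only the terms with `n ≤ r` contribute in depth `r`. -/
noncomputable def expSeries (T : Mould → Mould) (P : Mould) : Mould := fun r =>
  (1 : Mould) r + ∑ n ∈ Finset.range r, (1 / ((n + 1).factorial : ℚ)) • (T^[n] P) r

/-- The operator `exp(T) = ∑_{n ≥ 0} (1/n!) Tⁿ`, for an operator `T` that raises the depth: only the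
terms with `n ≤ r` contribute in depth `r`. -/
noncomputable def expOp (T : Mould → Mould) (X : Mould) : Mould := fun r =>
  ∑ n ∈ Finset.range (r + 1), (1 / (n.factorial : ℚ)) • (T^[n] X) r

/-- `exp_ari(P) = ∑_{n ≥ 0} (1/n!) preari(P, …, P)`, with `n` arguments, composed from left to
right. -/
noncomputable def expari (P : Mould) : Mould := expSeries (fun Z => preari Z P) P

/-! ### Solving equations depth by depth -/

/-- The solution `X` of `Φ(X) = Q` with `X(∅) = X₀(∅)`, found depth by depth, when the depth `r`
part of `Φ(X) - X` depends only on the parts of `X` of depth `< r`. -/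
noncomputable def depthSolve (Φ : Mould → Mould) (Q X₀ : Mould) : Mould := fun r =>
  ((fun X => X + (Q - Φ X))^[r] X₀) r

theorem depthSolve_zero (Φ : Mould → Mould) (Q X₀ : Mould) :
    depthSolve Φ Q X₀ 0 = X₀ 0 := rfl

theorem depthSolve_spec {Φ : Mould → Mould} {Q X₀ : Mould}
    (h0 : ∀ X : Mould, X 0 = X₀ 0 → Φ X 0 = Q 0)
    (hc : ∀ (X Y : Mould) (r : ℕ), X 0 = X₀ 0 → Y 0 = X₀ 0 → (∀ s < r, X s = Y s) →
      Φ X r - X r = Φ Y r - Y r) :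
    Φ (depthSolve Φ Q X₀) = Q := by
  set Z : ℕ → Mould := fun n => (fun X => X + (Q - Φ X))^[n] X₀ with hZ
  have hs : ∀ n r, Z (n + 1) r = Z n r + (Q r - Φ (Z n) r) := fun n r => by
    simp only [hZ, Function.iterate_succ_apply']
    rfl
  have hz : ∀ n, Z n 0 = X₀ 0 := fun n => by
    induction n with
    | zero => rfl
    | succ n ih => rw [hs, h0 _ ih, ih]; simp
  have hst : ∀ r n m, r ≤ n → r ≤ m → Z n r = Z m r := fun r => by
    induction r using Nat.strong_induction_on with
    | _ r ih =>
      intro n m hn hm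
      rcases Nat.eq_zero_or_pos r with rfl | hr
      · rw [hz, hz]
      · obtain ⟨n, rfl⟩ : ∃ k, n = k + 1 := ⟨n - 1, by omega⟩
        obtain ⟨m, rfl⟩ : ∃ k, m = k + 1 := ⟨m - 1, by omega⟩
        have := hc (Z n) (Z m) r (hz n) (hz m) fun s hs' => ih s hs' n m (by omega) (by omega)
        rw [hs, hs]
        linear_combination -this
  have hX : ∀ r, depthSolve Φ Q X₀ r = Z r r := fun r => rfl
  ext r
  rcases Nat.eq_zero_or_pos r with rfl | hr
  · exact h0 _ (depthSolve_zero _ _ _)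
  · have h1 := hc (depthSolve Φ Q X₀) (Z r) r (depthSolve_zero _ _ _) (hz r)
      fun s hs' => by rw [hX]; exact hst s s r le_rfl hs'.le
    have h2 := hs r r
    rw [hst r (r + 1) r (by omega) le_rfl] at h2
    rw [hX r] at h1
    linear_combination h1 + h2

theorem expSeries_solve {T : Mould → Mould → Mould}
    (h0 : ∀ X Z : Mould, X 0 = 0 → Z 0 = 0 → T X Z 0 = 0)
    (hc : ∀ (X Y Z W : Mould) (r : ℕ), X 0 = 0 → Y 0 = 0 → Z 0 = 0 → W 0 = 0 →
      (∀ s < r, X s = Y s) → (∀ s < r, Z s = W s) → T X Z r = T Y W r)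
    {Q : Mould} (hQ : Q 0 = 1) :
    expSeries (T (depthSolve (fun X => expSeries (T X) X) Q 0))
      (depthSolve (fun X => expSeries (T X) X) Q 0) = Q := by
  have hit : ∀ (X : Mould), X 0 = 0 → ∀ n, ((T X)^[n] X) 0 = 0 := fun X hX n => by
    induction n with
    | zero => exact hX
    | succ n ih => rw [Function.iterate_succ_apply']; exact h0 _ _ hX ih
  have hag : ∀ (X Y : Mould) (r : ℕ), X 0 = 0 → Y 0 = 0 → (∀ s < r, X s = Y s) →
      ∀ n, (∀ s < r, ((T X)^[n] X) s = ((T Y)^[n] Y) s) ∧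
        ((T X)^[n + 1] X) r = ((T Y)^[n + 1] Y) r := fun X Y r hX hY h n => by
    induction n with
    | zero => exact ⟨h, hc _ _ _ _ _ hX hY hX hY h h⟩
    | succ n ih =>
      have h1 : ∀ s < r, ((T X)^[n + 1] X) s = ((T Y)^[n + 1] Y) s := fun s hs => by
        rw [Function.iterate_succ_apply', Function.iterate_succ_apply']
        exact hc _ _ _ _ _ hX hY (hit X hX n) (hit Y hY n) (fun t ht => h t (ht.trans hs))
          (fun t ht => ih.1 t (ht.trans hs))
      refine ⟨h1, ?_⟩
      rw [Function.iterate_succ_apply', Function.iterate_succ_apply' (T Y)]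
      exact hc _ _ _ _ _ hX hY (hit X hX _) (hit Y hY _) h h1
  refine depthSolve_spec (Φ := fun X => expSeries (T X) X) ?_ ?_
  · intro X _
    simp [expSeries, one_apply, hQ]
  · intro X Y r hX hY h
    have hX' : X 0 = 0 := hX
    have hY' : Y 0 = 0 := hY
    rcases r with _ | r
    · simp [expSeries, hX', hY']
    · simp only [expSeries, Finset.sum_range_succ' _ r, Function.iterate_zero, id]
      have : ∀ n, ((T X)^[n + 1] X) (r + 1) = ((T Y)^[n + 1] Y) (r + 1) :=
        fun n => (hag X Y _ hX' hY' h n).2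
      simp only [this]
      simp
      ring

/-! ### Depth estimates -/

theorem eval_congr {L : Type*} [Field L] [Algebra ℚ L] {P Q : Mould} {w : List L}
    (h : P w.length = Q w.length) : P.eval w = Q.eval w := by
  rw [eval, eval, h]

theorem eval_of_length_zero {L : Type*} [Field L] [Algebra ℚ L] {P : Mould} {w : List L}
    (hw : w.length = 0) (h : P 0 = 0) : P.eval w = 0 := by
  rw [eval_congr (Q := 0) (by rw [hw, h]; rfl), eval_zero]

theorem mul_congr {P Q P' Q' : Mould} {r : ℕ} (hP : P 0 = 0) (hQ : Q 0 = 0) (hP' : P' 0 = 0)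
    (hQ' : Q' 0 = 0) (h : ∀ s < r, P s = P' s) (h' : ∀ s < r, Q s = Q' s) :
    (P * Q) r = (P' * Q') r := by
  rw [mul_apply, mul_apply]
  refine Finset.sum_congr rfl fun i hi => ?_
  have hi : i < r + 1 := Finset.mem_range.1 hi
  rcases Nat.eq_zero_or_pos i with rfl | h1
  · rw [eval_of_length_zero (by simp) hP, eval_of_length_zero (by simp) hP']; simp
  · rcases Nat.eq_or_lt_of_le (Nat.lt_succ_iff.1 hi) with rfl | h2
    · rw [eval_of_length_zero (P := Q) (by simp) hQ, eval_of_length_zero (P := Q') (by simp) hQ']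
      simp
    · rw [eval_congr (h _ _), eval_congr (P := Q) (h' _ _)] <;> simp <;> omega

theorem arit_congr {F G M N : Mould} {r : ℕ} (hF : F 0 = 0) (hG : G 0 = 0)
    (h : ∀ s < r, F s = G s) (h' : ∀ s < r, M s = N s) : arit F M r = arit G N r := by
  refine Finset.sum_congr rfl fun j hj => Finset.sum_congr rfl fun i hi => ?_
  simp only [Finset.mem_range] at hi hj
  rcases Nat.eq_or_lt_of_le (Nat.lt_succ_iff.1 hi) with rfl | h1
  · have hb : (((gen r).take i).drop i).length = 0 := by simp
    simp only [eval_of_length_zero hb hF, eval_of_length_zero hb hG]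
    simp
  · dsimp only
    congr 1
    · split_ifs with hc
      · rfl
      · have hl : ((gen r).drop j).length ≠ 0 := fun h0 => hc (List.length_eq_zero_iff.1 h0)
        simp only [List.length_drop, length_gen] at hl
        rw [eval_congr (h' _ _), eval_congr (P := F) (h _ _)] <;>
          simp only [List.length_append, length_addHead, List.length_take, List.length_drop,
            length_gen] <;> omega
    · split_ifs with hc
      · rfl
      · have hl : ((gen r).take i).length ≠ 0 := fun h0 => hc (List.length_eq_zero_iff.1 h0)
        simp only [List.length_take, length_gen] at hl
        rw [eval_congr (h' _ _), eval_congr (P := F) (h _ _)] <;> simp <;> omega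

theorem arit_zero_depth (F M : Mould) : arit F M 0 = 0 := by
  have h : (gen 0) = [] := List.length_eq_zero_iff.1 (length_gen 0)
  simp [arit, h]

/-- The inverse `log_ari : GARI → ARI` of `exp_ari`. -/
noncomputable def logari (Q : Mould) : Mould := depthSolve expari Q 0

theorem logari_mem (Q : Mould) : logari Q ∈ ARI := rfl

theorem expari_logari {Q : Mould} (hQ : Q ∈ GARI) : expari (logari Q) = Q := by
  refine expSeries_solve (T := fun P Z => preari Z P) ?_ ?_ hQ
  · intro X Z hX hZ
    simp [preari, mul_zero_depth, hX, arit_zero_depth]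
  · intro X Y Z W r hX hY hZ hW h h'
    simp only [preari, add_apply]
    rw [mul_congr hZ hX hW hY h' h, arit_congr hX hY h h']

/-! ### The group law `gari` -/

/-- The inverse for the product `mu` of a mould `P ∈ GARI`: the geometric series
`∑_{n ≥ 0} (1 - P)ⁿ`, of which only the terms with `n ≤ r` contribute in depth `r`. -/
noncomputable def invmu (P : Mould) : Mould := fun r =>
  ∑ n ∈ Finset.range (r + 1), ((1 - P) ^ n) r

/-- `d = [(a₁, b₁, c₁), …, (a_s, b_s, c_s)]` is a cutting `u = a₁ b₁ c₁ ⋯ a_s b_s c_s` of the word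
`u`, in which no `b_i` is empty and no interior double chunk `c_i a_{i+1}` is empty. -/
structure IsCut {α : Type*} (u : List α) (d : List (List α × List α × List α)) : Prop where
  concat : (d.map fun t => t.1 ++ t.2.1 ++ t.2.2).flatten = u
  ne_nil : ∀ t ∈ d, t.2.1 ≠ []
  interior : d.IsChain fun t t' => t.2.2 ≠ [] ∨ t'.1 ≠ []

/-- The word `⌈b₁⌉ ⋯ ⌈b_s⌉`, where `⌈b_i⌉` is `b_i` with its first letter increased by the sum of
the letters of `a_i` and its last letter increased by the sum of the letters of `c_i`. -/
def flexWord {α : Type*} [AddMonoid α] (d : List (List α × List α × List α)) : List α :=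
  (d.map fun t => addLast t.2.2.sum (addHead t.1.sum t.2.1)).flatten

/-- `garit(P) · Q`, evaluated on `u = (u₁, …, u_r)`, is the sum over the cuttings of `u` of
`Q(⌈b₁⌉ ⋯ ⌈b_s⌉) P(a₁) ⋯ P(a_s) P⁻¹(c₁) ⋯ P⁻¹(c_s)`. -/
noncomputable def garit (P Q : Mould) : Mould := fun r =>
  ∑ᶠ d ∈ {d | IsCut (gen r) d},
    Q.eval (flexWord d) * (d.map fun t => P.eval t.1 * (invmu P).eval t.2.2).prod

/-- The group law `gari(P, Q) = (garit(Q) · P) Q` on `GARI`. -/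
noncomputable def gari (P Q : Mould) : Mould := garit Q P * Q

/-- The inverse of `P` in the group `GARI` with the law `gari`: the solution `X ∈ GARI` of
`gari(X, P) = 1`. -/
noncomputable def invgari (P : Mould) : Mould := depthSolve (fun X => gari X P) 1 1

theorem invgari_mem (P : Mould) : invgari P ∈ GARI := by
  change depthSolve _ _ _ 0 = 1
  rw [depthSolve_zero]; simp [one_apply]

theorem finite_isCut {α : Type*} (u : List α) : {d | IsCut u d}.Finite := by
  set B : Set (List α) := {l | l ∈ u.sublists} with hB
  have hBf : B.Finite := List.finite_toSet _
  have hA : (B ×ˢ B ×ˢ B).Finite := hBf.prod (hBf.prod hBf)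
  have : Finite (B ×ˢ B ×ˢ B : Set _) := hA
  refine Set.Finite.subset ((List.finite_length_le (B ×ˢ B ×ˢ B : Set _) u.length).image
    (List.map Subtype.val)) ?_
  intro d hd
  have hsub : ∀ t ∈ d, (t.1 ++ t.2.1 ++ t.2.2).Sublist u := fun t ht => by
    rw [← hd.concat]
    exact List.sublist_flatten_of_mem (List.mem_map.2 ⟨t, ht, rfl⟩)
  have hmem : ∀ t ∈ d, t ∈ (B ×ˢ B ×ˢ B : Set _) := fun t ht => by
    have h := hsub t ht
    simp only [hB, Set.mem_prod, Set.mem_ofPred_eq, List.mem_sublists]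
    refine ⟨((List.sublist_append_left _ _).trans (List.sublist_append_left _ _)).trans h,
      ((List.sublist_append_right _ _).trans (List.sublist_append_left _ _)).trans h,
      (List.sublist_append_right _ _).trans h⟩
  have hlen : d.length ≤ u.length := by
    rw [← hd.concat, List.length_flatten, List.map_map]
    calc d.length = (d.map fun t => t.1 ++ t.2.1 ++ t.2.2).length := by simp
      _ ≤ _ := by
        have h1 : ∀ x ∈ d.map (List.length ∘ fun t => t.1 ++ t.2.1 ++ t.2.2), 1 ≤ x := by
          intro x hx
          obtain ⟨t, ht, rfl⟩ := List.mem_map.1 hx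
          have := List.length_pos_of_ne_nil (hd.ne_nil t ht)
          simp; omega
        have := List.card_nsmul_le_sum _ 1 h1
        simpa using this
  lift d to List (B ×ˢ B ×ˢ B : Set _) using hmem
  exact ⟨d, by simpa using hlen, rfl⟩

theorem length_flexWord {α : Type*} [AddMonoid α] (d : List (List α × List α × List α)) :
    (flexWord d).length = (d.map fun t => t.2.1.length).sum := by
  simp [flexWord, List.length_flatten, Function.comp_def]

theorem IsCut.length_add {α : Type*} [AddMonoid α] {u : List α}
    {d : List (List α × List α × List α)} (h : IsCut u d) :
    (flexWord d).length + (d.map fun t => t.1.length + t.2.2.length).sum = u.length := by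
  rw [length_flexWord, ← List.sum_map_add, ← h.concat, List.length_flatten, List.map_map]
  congr 1
  refine List.map_congr_left fun t _ => ?_
  simp; omega

theorem IsCut.length_le {α : Type*} [AddMonoid α] {u : List α}
    {d : List (List α × List α × List α)} (h : IsCut u d) : (flexWord d).length ≤ u.length := by
  have := h.length_add
  omega

theorem IsCut.eq_of_length {α : Type*} [AddMonoid α] {u : List α} (hu : u ≠ [])
    {d : List (List α × List α × List α)} (h : IsCut u d) (hl : (flexWord d).length = u.length) :
    d = [([], u, [])] := by
  have h1 := h.length_add
  have h2 : (d.map fun t => t.1.length + t.2.2.length).sum = 0 := by omega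
  rw [List.sum_eq_zero_iff] at h2
  have h3 : ∀ t ∈ d, t.1 = [] ∧ t.2.2 = [] := fun t ht => by
    have := h2 _ (List.mem_map.2 ⟨t, ht, rfl⟩)
    exact ⟨List.length_eq_zero_iff.1 (by omega), List.length_eq_zero_iff.1 (by omega)⟩
  match d, h, h3 with
  | [], h, _ => exact absurd h.concat.symm (by simpa using hu)
  | [t], h, h3 =>
    obtain ⟨ha, hc⟩ := h3 t (by simp)
    have := h.concat
    obtain ⟨a, b, c⟩ := t
    simp_all
  | t :: t' :: d, h, h3 =>
    have := h.interior
    obtain ⟨ha, hc⟩ := h3 t (by simp)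
    obtain ⟨ha', hc'⟩ := h3 t' (by simp)
    simp [ha', hc] at this

theorem isCut_single {α : Type*} {u : List α} (hu : u ≠ []) : IsCut u [([], u, [])] :=
  ⟨by simp, by simpa using hu, by simp⟩

theorem flexWord_single {α : Type*} [AddMonoid α] (u : List α) :
    flexWord [([], u, [])] = u := by
  have h : ∀ l : List α, addHead 0 l = l := fun l => by cases l <;> simp [addHead]
  simp [flexWord, addLast, h]

theorem invmu_zero_depth (P : Mould) : invmu P 0 = 1 := by
  simp [invmu, one_apply]

theorem eval_nil_of_zero_depth {L : Type*} [Field L] [Algebra ℚ L] {P : Mould} (hP : P 0 = 1) :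
    P.eval ([] : List L) = 1 := by
  rw [eval_congr (Q := 1) (by simpa [one_apply] using hP), eval_one]; simp

theorem garit_sub (P X Y : Mould) (r : ℕ) : garit P X r - garit P Y r =
    ∑ᶠ d ∈ {d | IsCut (gen r) d}, (X.eval (flexWord d) - Y.eval (flexWord d)) *
      (d.map fun t => P.eval t.1 * (invmu P).eval t.2.2).prod := by
  rw [garit, garit, ← finsum_mem_sub_distrib _ _ (finite_isCut _)]
  simp only [sub_mul]

theorem garit_congr {P X Y : Mould} {r : ℕ} (h : ∀ s ≤ r, X s = Y s) :
    garit P X r = garit P Y r := by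
  rw [← sub_eq_zero, garit_sub]
  refine finsum_mem_eq_zero_of_forall_eq_zero fun d hd => ?_
  have hl := IsCut.length_le hd
  rw [length_gen] at hl
  rw [eval_congr (h _ hl)]
  simp

theorem garit_sub_eq {P X Y : Mould} {r : ℕ} (hP : P 0 = 1) (hr : r ≠ 0)
    (h : ∀ s < r, X s = Y s) : garit P X r - garit P Y r = X r - Y r := by
  have hu : gen r ≠ [] := fun h0 => hr (by simpa using congrArg List.length h0)
  rw [garit_sub]
  refine (finsum_eq_single _ [([], gen r, [])] ?_).trans ?_
  rotate_left
  · simp [isCut_single hu, flexWord_single, eval_gen, eval_nil_of_zero_depth hP,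
      eval_nil_of_zero_depth (invmu_zero_depth P)]
  · intro d hne
    classical
    rw [finsum_eq_if]
    split_ifs with hd
    swap
    · rfl
    have hl := IsCut.length_le hd
    have hl2 : (flexWord d).length ≠ (gen r).length := fun h0 => hne (IsCut.eq_of_length hu hd h0)
    rw [length_gen] at hl hl2
    rw [eval_congr (h _ (by omega))]
    simp

theorem garit_zero_depth (P X : Mould) : garit P X 0 = X 0 := by
  have h : (gen 0) = [] := List.length_eq_zero_iff.1 (length_gen 0)
  have hS : {d : List (List (RatFun 0) × List (RatFun 0) × List (RatFun 0)) | IsCut (gen 0) d}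
      = {[]} := by
    ext d
    simp only [Set.mem_ofPred_eq, Set.mem_singleton_iff, h]
    constructor
    · intro hd
      by_contra hne
      obtain ⟨t, ht⟩ := List.exists_mem_of_ne_nil d hne
      have := hd.concat
      rw [List.flatten_eq_nil_iff] at this
      have := this _ (List.mem_map.2 ⟨t, ht, rfl⟩)
      exact hd.ne_nil t ht (by simp at this; exact this.2.1)
    · rintro rfl
      exact ⟨rfl, by simp, by simp⟩
  rw [garit, hS, finsum_mem_singleton]
  simp only [flexWord, List.map_nil, List.flatten_nil, List.prod_nil, mul_one]
  rw [← h, eval_gen]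

theorem gari_invgari {P : Mould} (hP : P ∈ GARI) : gari (invgari P) P = 1 := by
  have hP : P 0 = 1 := hP
  refine depthSolve_spec (Φ := fun X => gari X P) ?_ ?_
  · intro X hX
    simp [gari, mul_zero_depth, garit_zero_depth, hX, hP]
  · intro X Y r hX hY h
    rcases Nat.eq_zero_or_pos r with rfl | hr
    · simp [gari, mul_zero_depth, garit_zero_depth, hP]
    · have hd : (gen r).drop r = [] := List.drop_of_length_le (by simp)
      have ht : (gen r).take r = gen r := List.take_of_length_le (by simp)
      have h1 : ∀ i ∈ Finset.range r, (garit P X).eval ((gen r).take i) * P.eval ((gen r).drop i)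
          = (garit P Y).eval ((gen r).take i) * P.eval ((gen r).drop i) := fun i hi => by
        have hi := Finset.mem_range.1 hi
        rw [eval_congr (garit_congr fun s hs => h s (by simp at hs; omega))]
      simp only [gari, mul_apply, Finset.sum_range_succ, hd, ht, eval_gen,
        eval_nil_of_zero_depth hP]
      rw [Finset.sum_congr rfl h1]
      linear_combination garit_sub_eq (r := r) hP hr.ne' h

/-! ### The adjoint action -/

/-- The adjoint action of `P ∈ GARI` (with the law `gari`) on its Lie algebra `ARI` (with the
bracket `ari`): `Ad_ari(P) = exp(ad_ari(log_ari(P)))`. -/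
noncomputable def Adari (P F : Mould) : Mould := expOp (ari (logari P)) F

/-! ### The moulds `dupal`, `pal` and `invpal` -/

/-- `dupal(u₁, …, u_r) = (B_r / r!) (u₁ ⋯ u_r)⁻¹ ∑_{0 ≤ j < r} (-1)^j binom(r-1, j) u_{j+1}`. -/
noncomputable def dupal : Mould := fun r =>
  (bernoulli r / (r.factorial : ℚ)) • ((gen r).prod⁻¹ *
    ∑ j : Fin r, ((-1 : ℚ) ^ (j : ℕ) * ((r - 1).choose j : ℚ)) •
      (gen r)[(j : ℕ)]'(by simp))

/-- `pal(∅) = 1` and `(u₁ + ⋯ + u_r) pal(u₁, …, u_r) =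
∑_{0 ≤ i < r} pal(u₁, …, u_i) dupal(u_{i+1}, …, u_r)` for `r ≥ 1`. -/
noncomputable def pal : Mould
  | 0 => 1
  | r + 1 => (gen (r + 1)).sum⁻¹ * ∑ i : Fin (r + 1),
      evalRat (pal i) (fun k : Fin i => (gen (r + 1))[(k : ℕ)]'(by simp; omega)) *
        dupal.eval ((gen (r + 1)).drop i)

theorem pal_mem : pal ∈ GARI := by
  change pal 0 = 1
  rw [pal]

theorem sum_gen_ne_zero {r : ℕ} (hr : r ≠ 0) : (gen r).sum ≠ 0 := by
  intro h
  rw [gen, List.sum_ofFn, ← map_sum, map_eq_zero_iff _ (IsFractionRing.injective _ _)] at h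
  have h2 := congrArg (MvPolynomial.eval fun _ => (1 : ℚ)) h
  simp [map_sum, hr] at h2

theorem dur_pal {r : ℕ} (hr : r ≠ 0) : dur pal r = (pal * dupal) r := by
  have hd : dupal 0 = 0 := by simp [dupal]
  obtain ⟨r, rfl⟩ := Nat.exists_eq_succ_of_ne_zero hr
  rw [mul_apply, Finset.sum_range_succ, eval_of_length_zero (P := dupal) (by simp) hd, mul_zero,
    add_zero, dur, durFactor, if_neg hr, pal, mul_inv_cancel_left₀ (sum_gen_ne_zero hr),
    Finset.sum_range]
  refine Finset.sum_congr rfl fun i _ => ?_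
  rw [eval_eq_of_length (n := i) pal _ (by simp)]
  congr 2
  funext k
  simp

/-- The inverse of `pal` in the group `GARI` with the law `gari`. -/
noncomputable def invpal : Mould := invgari pal

/-! ### `Darit`, its exponential, and `Δ*` -/

/-- `Darit(P) = -dar ∘ (arit(Δ⁻¹(P)) - ad(Δ⁻¹(P))) ∘ dar⁻¹`. -/
noncomputable def Darit (P X : Mould) : Mould :=
  -dar (arit (DeltaInv P) (darInv X) - ⁅DeltaInv P, darInv X⁆)

/-- `exp_Dari(P) = 1 + ∑_{n ≥ 1} (1/n!) Darit(P)^{n-1}(P)`. -/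
noncomputable def expDari (P : Mould) : Mould := expSeries (Darit P) P

/-- The inverse `log_Dari : GARI → ARI` of `exp_Dari`. -/
noncomputable def logDari (Q : Mould) : Mould := depthSolve expDari Q 0

theorem logDari_mem (Q : Mould) : logDari Q ∈ ARI := rfl

theorem expDari_logDari {Q : Mould} (hQ : Q ∈ GARI) : expDari (logDari Q) = Q := by
  refine expSeries_solve (T := Darit) ?_ ?_ hQ
  · intro X Z hX hZ
    simp [Darit, dar, lie_def, mul_zero_depth, arit_zero_depth, DeltaInv, hX]
  · intro X Y Z W r hX hY hZ hW h h'
    have h1 : ∀ {P : Mould}, P 0 = 0 → DeltaInv P 0 = 0 := fun hP => by simp [DeltaInv, hP]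
    have h2 : ∀ {P : Mould}, P 0 = 0 → darInv P 0 = 0 := fun hP => by simp [darInv, hP]
    have h3 : ∀ s < r, DeltaInv X s = DeltaInv Y s := fun s hs => by simp [DeltaInv, h s hs]
    have h4 : ∀ s < r, darInv Z s = darInv W s := fun s hs => by simp [darInv, h' s hs]
    simp only [Darit, dar, lie_def, neg_apply, sub_apply]
    rw [arit_congr (h1 hX) (h1 hY) h3 h4, mul_congr (h1 hX) (h2 hZ) (h1 hY) (h2 hW) h3 h4,
      mul_congr (h2 hZ) (h1 hX) (h2 hW) (h1 hY) h4 h3]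

/-- `Dgarit(P) = exp(Darit(log_Dari(P)))` for `P ∈ GARI`. -/
noncomputable def Dgarit (P X : Mould) : Mould := expOp (Darit (logDari P)) X

/-- `Δ* = exp_Dari ∘ Δ ∘ log_ari`. -/
noncomputable def Deltastar (Q : Mould) : Mould := expDari (Delta (logari Q))

/-! ### The Lie algebra `ARI` extended by an element `a` with `[Q, a] = dur(Q)` -/

theorem eval_dur {L : Type*} [Field L] [Algebra ℚ L] {w : List L} (hw : Indep w) {P : Mould}
    (hP : P 0 = 0) : (dur P).eval w = w.sum * P.eval w := by
  rcases Nat.eq_zero_or_pos w.length with h | h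
  · rw [eval_of_length_zero h hP, eval_of_length_zero h (by simp [dur, hP])]; simp
  · rw [eval_eq_evalHom hw, eval_eq_evalHom hw, dur, durFactor, if_neg (by omega), map_mul,
      map_list_sum, map_gen]

theorem dur_mul {P Q : Mould} (hP : P 0 = 0) (hQ : Q 0 = 0) :
    dur (P * Q) = dur P * Q + P * dur Q := by
  have hPQ : (P * Q) 0 = 0 := by simp [mul_zero_depth, hP]
  ext r
  conv_lhs => rw [← eval_gen (dur (P * Q)), eval_dur (indep_gen r) hPQ, eval_gen]
  rw [add_apply, mul_apply, mul_apply, mul_apply, Finset.mul_sum, ← Finset.sum_add_distrib]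
  refine Finset.sum_congr rfl fun i _ => ?_
  rw [eval_dur (indep_take r i) hP, eval_dur (indep_drop r i) hQ]
  have h : (gen r).sum = ((gen r).take i).sum + ((gen r).drop i).sum := by
    rw [← List.sum_append, List.take_append_drop]
  rw [h]
  ring

/-- The derivation `dur` of `ARI`. -/
noncomputable def durDer : LieDerivation ℚ ARI ARI where
  toFun X := ⟨dur X.1, by have : X.1 0 = 0 := X.2; simp [mem_ARI, dur, this]⟩
  map_add' X Y := by
    apply Subtype.ext
    ext r
    simp [dur, mul_add]
  map_smul' q X := by
    apply Subtype.ext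
    ext r
    simp [dur]
  leibniz' X Y := by
    have hX : X.1 0 = 0 := X.2
    have hY : Y.1 0 = 0 := Y.2
    have h : ∀ A B : Mould, dur (A - B) = dur A - dur B := fun A B => by
      ext r; simp [dur, mul_sub]
    apply Subtype.ext
    change dur (X.1 * Y.1 - Y.1 * X.1) =
      (X.1 * dur Y.1 - dur Y.1 * X.1) - (Y.1 * dur X.1 - dur X.1 * Y.1)
    rw [h, dur_mul hX hY, dur_mul hY hX]
    abel

/-- The one-dimensional (abelian) Lie algebra `ℚ a`. -/
noncomputable instance : LieRing ℚ := LieRing.ofAssociativeRing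
noncomputable instance : LieAlgebra ℚ ℚ := LieAlgebra.ofAssociativeAlgebra

/-- The action `ad(t a) = -t dur` of `ℚ a` on `ARI`. -/
noncomputable def adA : ℚ →ₗ⁅ℚ⁆ LieDerivation ℚ ARI ARI where
  toFun t := -(t • durDer)
  map_add' s t := by rw [add_smul, neg_add]
  map_smul' q t := by simp [mul_smul]
  map_lie' {s t} := by
    have h : ⁅s, t⁆ = 0 := by
      change s * t - t * s = 0
      ring
    rw [h]
    simp

/-- `ARI^a = ARI ⊕ ℚ a`, with the bracket `lu` extended by `[Q, a] = dur(Q)`; the element `X + t a`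
is the pair `⟨X, t⟩`. -/
abbrev ARIa : Type := LieAlgebra.SemiDirectSum ARI ℚ adA

/-- The derivation `D` of `ARI^a` extends `Darit(P)` and maps `a` to `P`. -/
def ExtendsDarit (P : Mould) (D : LieDerivation ℚ ARIa ARIa) : Prop :=
  ∀ Z : ARIa, ((D Z).left : Mould) = Darit P Z.left + Z.right • P ∧ (D Z).right = 0

/-- The automorphism `φ` of `ARI^a` extends `Dgarit(P)` and maps `a` to `a - 1 + P`. -/
def ExtendsDgarit (P : Mould) (φ : ARIa ≃ₗ⁅ℚ⁆ ARIa) : Prop :=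
  ∀ Z : ARIa, ((φ Z).left : Mould) = Dgarit P Z.left + Z.right • (P - 1) ∧
    (φ Z).right = Z.right

end Mould

end EcalleMould

open EcalleMould Mould

namespace EcalleMould

section WordFunctions

variable {α R : Type*} [CommRing R]

/-- The sum of `K y z` over all factorizations `u = y z` of a word. -/
def splitSum {α R : Type*} [Add R] (K : List α → List α → R) : List α → R
  | [] => K [] []
  | x :: w => K [] (x :: w) + splitSum (fun y z => K (x :: y) z) w

theorem splitSum_congr {K K' : List α → List α → R} {u : List α}
    (h : ∀ y z, y ++ z = u → K y z = K' y z) : splitSum K u = splitSum K' u := by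
  induction u generalizing K K' with
  | nil => exact h _ _ rfl
  | cons x w ih =>
    simp only [splitSum]
    rw [h [] _ rfl, ih fun y z hyz => h _ _ (by simp [hyz])]

theorem splitSum_add (K K' : List α → List α → R) (u : List α) :
    splitSum (fun y z => K y z + K' y z) u = splitSum K u + splitSum K' u := by
  induction u generalizing K K' with
  | nil => rfl
  | cons x w ih => simp only [splitSum, ih]; abel

theorem splitSum_sub (K K' : List α → List α → R) (u : List α) :
    splitSum (fun y z => K y z - K' y z) u = splitSum K u - splitSum K' u := by
  induction u generalizing K K' with
  | nil => rfl
  | cons x w ih => simp only [splitSum, ih]; abel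

theorem splitSum_const_mul (c : R) (K : List α → List α → R) (u : List α) :
    splitSum (fun y z => c * K y z) u = c * splitSum K u := by
  induction u generalizing K with
  | nil => rfl
  | cons x w ih => simp only [splitSum, ih, mul_add]

theorem splitSum_mul_const (c : R) (K : List α → List α → R) (u : List α) :
    splitSum (fun y z => K y z * c) u = splitSum K u * c := by
  simp only [mul_comm _ c, splitSum_const_mul]

theorem splitSum_zero (u : List α) : splitSum (fun _ _ => (0 : R)) u = 0 := by
  simpa using splitSum_const_mul (0 : R) (fun _ _ => 0) u

theorem splitSum_assoc (K : List α → List α → List α → R) (u : List α) :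
    splitSum (fun x t => splitSum (fun y z => K x y z) t) u =
      splitSum (fun t z => splitSum (fun x y => K x y z) t) u := by
  induction u generalizing K with
  | nil => rfl
  | cons a w ih =>
    simp only [splitSum, splitSum_add]
    rw [ih]
    abel

theorem splitSum_eq_sum_range (K : List α → List α → R) (u : List α) :
    splitSum K u = ∑ i ∈ Finset.range (u.length + 1), K (u.take i) (u.drop i) := by
  induction u generalizing K with
  | nil => simp [splitSum]
  | cons x w ih =>
    rw [splitSum, ih, List.length_cons, Finset.sum_range_succ' _ (w.length + 1)]
    simp [add_comm]

/-- The convolution product of functions on words. -/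
def conv (f g : List α → R) : List α → R := splitSum fun y z => f y * g z

theorem conv_assoc (f g h : List α → R) : conv (conv f g) h = conv f (conv g h) := by
  funext u
  simp only [conv, ← splitSum_mul_const, ← splitSum_const_mul, ← mul_assoc]
  exact (splitSum_assoc (fun x y z => f x * g y * h z) u).symm

theorem conv_sub (f g h : List α → R) : conv f (g - h) = conv f g - conv f h := by
  funext u
  simp only [conv, Pi.sub_apply, mul_sub, splitSum_sub]

theorem sub_conv (f g h : List α → R) : conv (f - g) h = conv f h - conv g h := by
  funext u
  simp only [conv, Pi.sub_apply, sub_mul, splitSum_sub]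

/-- The indicator function of the words of length `1`. -/
def letter : List α → R
  | [_] => 1
  | _ => 0

theorem splitSum_letter_mul (g : List α → List α → R) (x : α) (w : List α) :
    splitSum (fun y z => letter y * g y z) (x :: w) = g [x] w := by
  cases w with
  | nil => simp [splitSum, letter]
  | cons a w => simp [splitSum, letter, splitSum_zero]

theorem splitSum_letter_mul_nil (g : List α → List α → R) :
    splitSum (fun y z => letter y * g y z) [] = 0 := by
  simp [splitSum, letter]

theorem splitSum_mul_letter (g : List α → List α → R) (x : α) (w : List α) :
    splitSum (fun y z => letter z * g y z) (w ++ [x]) = g w [x] := by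
  induction w generalizing g with
  | nil => simp [splitSum, letter]
  | cons a w ih =>
    rw [List.cons_append, splitSum, ih]
    cases w <;> simp [letter]

/-- The commutator of `f` with the indicator function of the letters. -/
def weight (f : List α → R) : List α → R := conv f letter - conv letter f

theorem weight_nil (f : List α → R) : weight f [] = 0 := by
  simp [weight, conv, splitSum, letter]

variable [AddCommMonoid α]

/-- The operator that contracts a factor `y` of a word to the letter `∑ y`, with weight `ε(y)`. -/
def contract (ε m : List α → R) (u : List α) : R :=
  splitSum (fun v t => splitSum (fun y w => ε y * m (v ++ y.sum :: w)) t) u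

/-- The part of `contract ε m` in which the contracted factor is an initial one. -/
def headContract (ε m : List α → R) (u : List α) : R :=
  splitSum (fun y z => ε y * m (y.sum :: z)) u

theorem headContract_nil {ε : List α → R} (hε : ε [] = 0) (m : List α → R) :
    headContract ε m [] = 0 := by simp [headContract, splitSum, hε]

theorem contract_nil {ε : List α → R} (hε : ε [] = 0) (m : List α → R) :
    contract ε m [] = 0 := by simp [contract, splitSum, hε]

theorem contract_cons (ε m : List α → R) (x : α) (w : List α) :
    contract ε m (x :: w) = headContract ε m (x :: w) + contract ε (fun l => m (x :: l)) w := rfl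

theorem contract_congr {ε m m' : List α → R} {u : List α} (hε : ε [] = 0)
    (h : ∀ v y w, v ++ y ++ w = u → y ≠ [] → m (v ++ y.sum :: w) = m' (v ++ y.sum :: w)) :
    contract ε m u = contract ε m' u := by
  refine splitSum_congr fun v t hvt => splitSum_congr fun y w hyw => ?_
  by_cases hy : y = []
  · simp [hy, hε]
  · rw [h v y w (by simp [hyw, hvt]) hy]

theorem contract_congr_left {ε η m : List α → R} {u : List α}
    (h : ∀ v y w, v ++ y ++ w = u → ε y = η y) :
    contract ε m u = contract η m u :=
  splitSum_congr fun v t hvt => splitSum_congr fun y w hyw => by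
    rw [h v y w (by simp [hyw, hvt])]

theorem contract_add (ε m m' : List α → R) (u : List α) :
    contract ε (fun l => m l + m' l) u = contract ε m u + contract ε m' u := by
  simp only [contract, mul_add, splitSum_add]

theorem contract_const_mul (ε m : List α → R) (c : R) (u : List α) :
    contract ε (fun l => c * m l) u = c * contract ε m u := by
  simp only [contract, mul_left_comm _ c, splitSum_const_mul]

theorem contract_mul_const (ε m : List α → R) (c : R) (u : List α) :
    contract ε (fun l => m l * c) u = contract ε m u * c := by
  simp only [mul_comm _ c, contract_const_mul]

theorem sub_contract (ε η m : List α → R) (u : List α) :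
    contract (ε - η) m u = contract ε m u - contract η m u := by
  simp only [contract, Pi.sub_apply, sub_mul, splitSum_sub]

theorem add_contract (ε η m : List α → R) (u : List α) :
    contract (ε + η) m u = contract ε m u + contract η m u := by
  simp only [contract, Pi.add_apply, add_mul, splitSum_add]

theorem const_mul_contract (c : R) (ε m : List α → R) (u : List α) :
    contract (fun l => c * ε l) m u = c * contract ε m u := by
  simp only [contract, mul_assoc, splitSum_const_mul]

/-- Contraction preserves the sum of the letters of a word. -/
theorem contract_sum (ε : List α → R) (g : α → List α → R) (u : List α) :
    contract ε (fun l => g l.sum l) u = contract ε (g u.sum) u := by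
  refine splitSum_congr fun v t hvt => splitSum_congr fun y w hyw => ?_
  subst hyw hvt
  simp

theorem headContract_splitSum (ε : List α → R) (K : List α → List α → R) (x : α) (w : List α) :
    headContract ε (splitSum K) (x :: w) = headContract ε (K []) (x :: w) +
      splitSum (fun t z => headContract ε (fun l => K l z) t) (x :: w) := by
  simp only [headContract, splitSum.eq_2 K, mul_add]
  rw [splitSum_add]
  congr 1
  simp only [← splitSum_const_mul]
  exact splitSum_assoc (fun y v z => ε y * K (y.sum :: v) z) (x :: w)

/-- Contraction is a derivation. -/
theorem contract_splitSum {ε : List α → R} (hε : ε [] = 0) (K : List α → List α → R)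
    (u : List α) : contract ε (splitSum K) u =
      splitSum (fun y z => contract ε (fun l => K l z) y + contract ε (K y) z) u := by
  induction u generalizing K with
  | nil => simp [contract_nil hε, splitSum]
  | cons x w ih =>
    have h1 : (fun l => splitSum K (x :: l)) =
        fun l => K [] (x :: l) + splitSum (fun y z => K (x :: y) z) l := rfl
    rw [contract_cons, h1, contract_add, ih, headContract_splitSum]
    simp only [splitSum]
    simp only [contract_nil hε, headContract_nil hε, contract_cons, splitSum_add]
    ring

theorem contract_conv {ε : List α → R} (hε : ε [] = 0) (f g : List α → R) :
    contract ε (conv f g) = conv (contract ε f) g + conv f (contract ε g) := by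
  funext u
  simp only [conv, contract_splitSum hε, contract_mul_const, contract_const_mul, Pi.add_apply,
    splitSum_add]

theorem contract_headContract {ε : List α → R} (hε : ε [] = 0) (η m : List α → R)
    (u : List α) : contract ε (headContract η m) u = headContract (contract ε η) m u +
      splitSum (fun y z => η y * contract ε (fun l => m (y.sum :: l)) z) u := by
  have h : headContract η m = splitSum (fun y z => η y * m (y.sum :: z)) := rfl
  rw [h, contract_splitSum hε, splitSum_add]
  congr 1
  swap
  · exact splitSum_congr fun y z _ => contract_const_mul ε (fun l => m (y.sum :: l)) (η y) z
  refine splitSum_congr fun y z _ => ?_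
  rw [contract_sum ε (fun s l => η l * m (s :: z)), contract_mul_const]

theorem contract_comm {ε η : List α → R} (hε : ε [] = 0) (hη : η [] = 0) (m : List α → R)
    (u : List α) : contract ε (contract η m) u - contract η (contract ε m) u =
      contract (contract ε η - contract η ε) m u := by
  induction u generalizing m with
  | nil =>
    rw [contract_nil hε, contract_nil hη, contract_nil (by simp [contract_nil hε, contract_nil hη])]
    simp
  | cons x w ih =>
    have key : ∀ {ε η : List α → R}, ε [] = 0 →
        contract ε (contract η m) (x :: w) = headContract (contract ε η) m (x :: w) +
          splitSum (fun y z => η y * contract ε (fun l => m (y.sum :: l)) z) (x :: w) +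
          splitSum (fun y z => ε y * contract η (fun l => m (y.sum :: l)) z) (x :: w) +
          contract ε (contract η fun l => m (x :: l)) w := by
      intro ε η hε
      have h1 : (fun l => contract η m (x :: l)) =
          fun l => headContract η m (x :: l) + contract η (fun l => m (x :: l)) l := rfl
      have h2 : headContract ε (contract η m) (x :: w) =
          headContract ε (headContract η m) (x :: w) +
          splitSum (fun y z => ε y * contract η (fun l => m (y.sum :: l)) z) (x :: w) := by
        simp only [headContract.eq_1 ε, contract_cons, mul_add, splitSum_add]
      have h3 := contract_headContract hε η m (x :: w)
      rw [contract_cons] at h3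
      rw [contract_cons, h1, contract_add, h2]
      linear_combination h3
    have h4 : headContract (contract ε η - contract η ε) m (x :: w) =
        headContract (contract ε η) m (x :: w) - headContract (contract η ε) m (x :: w) := by
      simp only [headContract, Pi.sub_apply, sub_mul, splitSum_sub]
    rw [key hε, key hη, contract_cons, h4, ← ih]
    ring

theorem contract_letter {ε : List α → R} (hε : ε [] = 0) : contract ε letter = ε := by
  have h : ∀ u : List α, headContract ε letter u = ε u := fun u => by
    have : ∀ e : List α → R, splitSum (fun y z => e y * letter (y.sum :: z)) u = e u := by
      induction u with
      | nil => intro e; simp [splitSum, letter]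
      | cons x w ih =>
        intro e
        have h2 := ih fun l => e (x :: l)
        rw [splitSum]
        simp only [letter, mul_zero, zero_add]
        rw [← h2]
        refine splitSum_congr fun y z _ => ?_
        cases z <;> simp [letter]
    exact this ε
  have h0 : ∀ u : List α, contract ε (fun _ => (0 : R)) u = 0 := fun u => by
    simp [contract, splitSum_zero]
  funext u
  cases u with
  | nil => rw [contract_nil hε, hε]
  | cons x w =>
    rw [contract_cons, h]
    have : contract ε (fun l => letter (x :: l)) w = contract ε (fun _ => (0 : R)) w :=
      contract_congr hε fun v y z _ _ => by cases v <;> simp [letter]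
    rw [this, h0, add_zero]

theorem contract_weight (f g : List α → R) :
    contract (weight f) (weight g) - contract (weight g) (weight f) =
      weight (contract (weight f) g - contract (weight g) f + (conv g f - conv f g)) := by
  have h : ∀ f g : List α → R, contract (weight f) (weight g) =
      conv (contract (weight f) g) letter + conv g (weight f)
        - (conv (weight f) g + conv letter (contract (weight f) g)) := by
    intro f g
    have h1 : contract (weight f) (weight g) =
        contract (weight f) (conv g letter) - contract (weight f) (conv letter g) := by
      funext u
      simp only [weight, contract, Pi.sub_apply, mul_sub, splitSum_sub]
    rw [h1, contract_conv (weight_nil f), contract_conv (weight_nil f),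
      contract_letter (weight_nil f)]
  have ha : ∀ f g h : List α → R, conv f (g + h) = conv f g + conv f h := by
    intro f g h; funext u; simp only [conv, Pi.add_apply, mul_add, splitSum_add]
  have ha' : ∀ f g h : List α → R, conv (f + g) h = conv f h + conv g h := by
    intro f g h; funext u; simp only [conv, Pi.add_apply, add_mul, splitSum_add]
  rw [h, h]
  simp only [weight.eq_1 (_ + _), ha, ha', conv_sub, sub_conv]
  simp only [weight, conv_sub, sub_conv, conv_assoc]
  abel

theorem splitSum_weight_left (f m : List α → R) (v u : List α) :
    splitSum (fun b c => if c = [] then 0 else f b * m (v ++ Mould.addHead b.sum c)) u =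
      splitSum (fun y w => conv f letter y * m (v ++ y.sum :: w)) u := by
  have h1 : splitSum (fun y w => conv f letter y * m (v ++ y.sum :: w)) u =
      splitSum (fun y w => splitSum (fun b z => letter z * (f b * m (v ++ (b ++ z).sum :: w))) y)
        u := by
    refine splitSum_congr fun y w _ => ?_
    rw [conv, ← splitSum_mul_const]
    refine splitSum_congr fun b z hbz => ?_
    rw [hbz]; ring
  rw [h1, ← splitSum_assoc (fun b z w => letter z * (f b * m (v ++ (b ++ z).sum :: w)))]
  refine splitSum_congr fun b c _ => ?_
  cases c with
  | nil => rw [splitSum_letter_mul_nil (fun (z w : List α) => f b * m (v ++ (b ++ z).sum :: w))]; simp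
  | cons x w =>
    rw [splitSum_letter_mul (fun (z w : List α) => f b * m (v ++ (b ++ z).sum :: w))]
    simp [Mould.addHead]

theorem splitSum_weight_right (f m : List α → R) (w u : List α) :
    splitSum (fun a b => if a = [] then 0 else f b * m (Mould.addLast b.sum a ++ w)) u =
      splitSum (fun v y => conv letter f y * m (v ++ y.sum :: w)) u := by
  have h1 : splitSum (fun v y => conv letter f y * m (v ++ y.sum :: w)) u =
      splitSum (fun v y => splitSum (fun z b => letter z * (f b * m (v ++ (z ++ b).sum :: w))) y)
        u := by
    refine splitSum_congr fun v y _ => ?_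
    rw [conv, ← splitSum_mul_const]
    refine splitSum_congr fun b z hbz => ?_
    rw [hbz]; ring
  rw [h1, splitSum_assoc (fun v z b => letter z * (f b * m (v ++ (z ++ b).sum :: w)))]
  refine splitSum_congr fun a b _ => ?_
  rcases List.eq_nil_or_concat a with rfl | ⟨v, x, rfl⟩
  · simp [splitSum, letter]
  · rw [List.concat_eq_append,
      splitSum_mul_letter (fun (v z : List α) => f b * m (v ++ (z ++ b).sum :: w))]
    simp [Mould.addLast, Mould.addHead, add_comm]

theorem contract_weight_eq (f m : List α → R) (u : List α) :
    contract (weight f) m u = splitSum (fun t c => splitSum (fun a b =>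
      (if c = [] then 0 else m (a ++ Mould.addHead b.sum c) * f b) -
        (if a = [] then 0 else m (Mould.addLast b.sum a ++ c) * f b)) t) u := by
  simp only [splitSum_sub, mul_comm (m _)]
  rw [weight, sub_contract]
  congr 1
  · rw [← splitSum_assoc (fun a b c => if c = [] then 0 else f b * m (a ++ Mould.addHead b.sum c))]
    exact splitSum_congr fun v t _ => (splitSum_weight_left f m v t).symm
  · simp only [splitSum_weight_right]
    exact splitSum_assoc (fun v y w => conv letter f y * m (v ++ y.sum :: w)) u

end WordFunctions

section Evaluation

variable {L L' : Type*} [Field L] [Algebra ℚ L] [Field L'] [Algebra ℚ L']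

theorem Indep.add_next {v w : List L} {x z : L} (h : Indep (v ++ x :: z :: w)) :
    Indep (v ++ (x + z) :: z :: w) := by
  set n := (v ++ x :: z :: w).length with hn
  have hlt : v.length < n := by simp [hn]
  have hlt' : v.length + 1 < n := by simp [hn]
  let f : Fin n → MvPolynomial (Fin n) ℚ := fun i => MvPolynomial.X i +
    if i = ⟨v.length, hlt⟩ then MvPolynomial.X ⟨v.length + 1, hlt'⟩ else 0
  let g : Fin n → MvPolynomial (Fin n) ℚ := fun i => MvPolynomial.X i -
    if i = ⟨v.length, hlt⟩ then MvPolynomial.X ⟨v.length + 1, hlt'⟩ else 0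
  have hf : AlgebraicIndependent ℚ f := by
    rw [algebraicIndependent_iff_injective_aeval]
    have hgf : ((MvPolynomial.aeval g).comp (MvPolynomial.aeval f) :
        MvPolynomial (Fin n) ℚ →ₐ[ℚ] MvPolynomial (Fin n) ℚ) = AlgHom.id ℚ _ := by
      ext1 i
      simp only [AlgHom.comp_apply, MvPolynomial.aeval_X, f, g, AlgHom.id_apply]
      split_ifs with hi
      · subst hi
        simp
      · simp [hi]
    exact Function.LeftInverse.injective (g := MvPolynomial.aeval g)
      fun p => by simpa using DFunLike.congr_fun hgf p
  have h2 := AlgebraicIndependent.aeval_of_algebraicIndependent h hf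
  have hl : (v ++ (x + z) :: z :: w).length = n := by simp [hn]
  have h3 := h2.comp (Fin.cast hl) (Fin.cast_injective _)
  unfold Indep
  convert h3 using 1
  funext i
  obtain ⟨i, hi⟩ := i
  simp only [Function.comp_apply, Fin.cast_mk, f, map_add, MvPolynomial.aeval_X,
    List.get_eq_getElem, Fin.mk.injEq]
  rcases lt_trichotomy i v.length with h0 | h0 | h0
  · simp [List.getElem_append_left, h0, h0.ne]
  · subst h0
    simp
  · obtain ⟨k, rfl⟩ := Nat.exists_eq_add_of_lt h0
    simp [List.getElem_append_right, add_assoc]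

theorem Indep.contract {v y w : List L} (h : Indep (v ++ y ++ w)) (hy : y ≠ []) :
    Indep (v ++ y.sum :: w) := by
  induction y with
  | nil => exact absurd rfl hy
  | cons x y ih =>
    rcases eq_or_ne y [] with rfl | hy'
    · simpa using h
    · clear ih hy
      induction y generalizing x with
      | nil => exact absurd rfl hy'
      | cons z y ih =>
        have h1 : Indep (v ++ (x + z) :: (y ++ w)) := by
          refine (Indep.add_next (w := y ++ w) (by simpa using h)).sublist ?_
          exact (List.Sublist.refl v).append ((List.sublist_cons_self z (y ++ w)).cons_cons _)
        rcases eq_or_ne y [] with rfl | hy''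
        · simpa using h1
        · have := ih (x + z) (by simpa using h1) hy''
          simpa [add_assoc] using this

theorem map_splitSum (φ : L →ₐ[ℚ] L') {K : List L → List L → L} {K' : List L' → List L' → L'}
    (h : ∀ y z, φ (K y z) = K' (y.map φ) (z.map φ)) (u : List L) :
    φ (splitSum K u) = splitSum K' (u.map φ) := by
  induction u generalizing K K' with
  | nil => exact h _ _
  | cons x w ih =>
    rw [splitSum, map_add, h, ih (K' := fun y z => K' (φ x :: y) z) fun y z => by simp [h]]
    rfl

theorem map_contract (φ : L →ₐ[ℚ] L') {ε m : List L → L} {ε' m' : List L' → L'}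
    (hε : ∀ w, φ (ε w) = ε' (w.map φ)) (hm : ∀ w, φ (m w) = m' (w.map φ)) (u : List L) :
    φ (contract ε m u) = contract ε' m' (u.map φ) := by
  refine map_splitSum φ (fun v t => ?_) u
  rw [map_splitSum φ (K' := fun y w => ε' y * m' (v.map φ ++ y.sum :: w)) fun y w => ?_]
  rw [map_mul, hε, hm]
  simp [map_list_sum]

theorem map_letter (φ : L →ₐ[ℚ] L') (w : List L) :
    φ (letter w) = (letter (w.map φ) : L') := by
  rcases w with _ | ⟨x, _ | ⟨y, w⟩⟩ <;> simp [letter]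

theorem map_weight (φ : L →ₐ[ℚ] L') (P : Mould) (w : List L) :
    φ (weight P.eval w) = weight P.eval (w.map φ) := by
  simp only [weight, Pi.sub_apply, map_sub, conv]
  congr 1 <;>
  · refine map_splitSum φ (fun y z => ?_) w
    rw [map_mul, map_letter, eval_map]

theorem eval_mul_eq_conv {w : List L} (hw : Indep w) (P Q : Mould) :
    (P * Q).eval w = conv P.eval Q.eval w := by
  rw [eval_mul hw, conv, splitSum_eq_sum_range]

namespace Mould

theorem arit_apply (F M : Mould) (r : ℕ) :
    arit F M r = EcalleMould.contract (weight F.eval) M.eval (gen r) := by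
  rw [contract_weight_eq, splitSum_eq_sum_range, arit, length_gen]
  refine Finset.sum_congr rfl fun j hj => ?_
  have hj : j < r + 1 := Finset.mem_range.1 hj
  rw [splitSum_eq_sum_range, List.length_take, length_gen, min_eq_left (by omega)]
  refine Finset.sum_congr rfl fun i hi => ?_
  have hi : i < j + 1 := Finset.mem_range.1 hi
  rw [List.take_take, min_eq_left (by omega)]

theorem eval_arit {w : List L} (hw : Indep w) (F M : Mould) :
    (arit F M).eval w = EcalleMould.contract (weight F.eval) M.eval w := by
  rw [eval_eq_evalHom hw, arit_apply]
  conv_rhs => rw [← map_gen hw]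
  exact map_contract _ (fun w => map_weight _ F w) (fun w => (eval_map _ M w).symm) _

theorem eval_sub {w : List L} (hw : Indep w) (P Q : Mould) :
    (P - Q).eval w = P.eval w - Q.eval w := by
  simp [eval_eq_evalHom hw]

end Mould

end Evaluation

namespace Mould

theorem weight_congr {L : Type*} [Field L] {f g : List L → L} {u : List L} (h : ∀ w, w.Sublist u → f w = g w) :
    weight f u = weight g u := by
  simp only [weight, Pi.sub_apply, conv]
  congr 1 <;>
  · refine splitSum_congr fun y z hyz => ?_
    subst hyz
    first
    | rw [h y (List.sublist_append_left _ _)]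
    | rw [h z (List.sublist_append_right _ _)]

theorem arit_congr_eval {F M : Mould} {r : ℕ} {m : List (RatFun r) → RatFun r}
    (h : ∀ w, Indep w → M.eval w = m w) :
    arit F M r = EcalleMould.contract (weight F.eval) m (gen r) := by
  rw [arit_apply]
  refine contract_congr (weight_nil _) fun v y w hu hy => h _ (Indep.contract ?_ hy)
  rw [hu]
  exact indep_gen r

theorem arit_congr_eval_left {F M : Mould} {r : ℕ} {f : List (RatFun r) → RatFun r}
    (h : ∀ w, Indep w → F.eval w = f w) :
    arit F M r = EcalleMould.contract (weight f) M.eval (gen r) := by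
  rw [arit_apply]
  refine contract_congr_left fun v y w hu => weight_congr fun z hz => h _ ?_
  refine (indep_gen r).sublist (hz.trans ?_)
  rw [← hu]
  exact (List.sublist_append_right v y).trans (List.sublist_append_left _ w)

theorem arit_add (F M N : Mould) : arit F (M + N) = arit F M + arit F N := by
  ext r
  rw [arit_congr_eval (m := fun w => M.eval w + N.eval w) fun w hw => eval_add hw M N,
    contract_add, add_apply, arit_apply, arit_apply]

theorem arit_smul (F : Mould) (q : ℚ) (M : Mould) : arit F (q • M) = q • arit F M := by
  ext r
  rw [arit_congr_eval (m := fun w => algebraMap ℚ _ q * M.eval w) fun w hw => by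
    rw [eval_smul hw, Algebra.smul_def], contract_const_mul, smul_apply, arit_apply,
    Algebra.smul_def]

theorem weight_add {L : Type*} [Field L] (f g : List L → L) :
    weight (f + g) = weight f + weight g := by
  funext u
  simp only [weight, Pi.add_apply, Pi.sub_apply, conv, add_mul, mul_add, splitSum_add]
  ring

theorem weight_const_mul {L : Type*} [Field L] (c : L) (f : List L → L) :
    weight (fun w => c * f w) = fun w => c * weight f w := by
  funext u
  simp only [weight, Pi.sub_apply, conv, mul_assoc, mul_left_comm _ c, splitSum_const_mul, mul_sub]

theorem add_arit (F G M : Mould) : arit (F + G) M = arit F M + arit G M := by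
  ext r
  rw [arit_congr_eval_left (f := F.eval + G.eval) fun w hw => eval_add hw F G, weight_add,
    add_contract, add_apply, arit_apply, arit_apply]

theorem smul_arit (q : ℚ) (F M : Mould) : arit (q • F) M = q • arit F M := by
  ext r
  rw [arit_congr_eval_left (f := fun w => algebraMap ℚ _ q * F.eval w) fun w hw => by
    rw [eval_smul hw, Algebra.smul_def], weight_const_mul, const_mul_contract, smul_apply,
    arit_apply, Algebra.smul_def]

/-- `arit(F)`, as a linear operator. -/
noncomputable def aritLin : Mould →ₗ[ℚ] Mould →ₗ[ℚ] Mould :=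
  LinearMap.mk₂ ℚ arit add_arit smul_arit arit_add fun q F M => arit_smul F q M

theorem arit_mul (F M N : Mould) : arit F (M * N) = arit F M * N + M * arit F N := by
  ext r
  rw [arit_congr_eval (m := conv M.eval N.eval) fun w hw => eval_mul_eq_conv hw M N,
    contract_conv (weight_nil _), Pi.add_apply, add_apply]
  conv_rhs => rw [← eval_gen (arit F M * N), ← eval_gen (M * arit F N),
    eval_mul_eq_conv (indep_gen r), eval_mul_eq_conv (indep_gen r)]
  congr 1
  · refine splitSum_congr fun y z h => ?_
    rw [eval_arit ((indep_gen r).sublist (by rw [← h]; exact List.sublist_append_left _ _))]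
  · refine splitSum_congr fun y z h => ?_
    rw [eval_arit ((indep_gen r).sublist (by rw [← h]; exact List.sublist_append_right _ _))]

theorem arit_ari (F G M : Mould) :
    arit (ari F G) M = arit G (arit F M) - arit F (arit G M) := by
  ext r
  rw [sub_apply, arit_congr_eval fun w hw => eval_arit hw F M,
    arit_congr_eval fun w hw => eval_arit hw G M,
    contract_comm (weight_nil _) (weight_nil _), contract_weight]
  refine arit_congr_eval_left fun w hw => ?_
  rw [ari, eval_add hw, eval_sub hw, eval_arit hw, eval_arit hw, lie_def, eval_sub hw,
    eval_mul_eq_conv hw, eval_mul_eq_conv hw]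
  rfl

theorem arit_dur (F : Mould) {M : Mould} (hM : M 0 = 0) : arit F (dur M) = dur (arit F M) := by
  ext r
  rw [arit_congr_eval (m := fun w => w.sum * M.eval w) fun w hw => eval_dur hw hM,
    contract_sum (weight F.eval) (fun s l => s * M.eval l), contract_const_mul,
    ← arit_apply]
  conv_rhs => rw [← eval_gen (dur _), eval_dur (indep_gen r) (arit_zero_depth F M), eval_gen]

end Mould

namespace Mould

/-! ### Depth filtration -/

/-- The moulds that vanish in depth `< n`. -/
def depthFil (n : ℕ) : Submodule ℚ Mould where
  carrier := {P | ∀ s < n, P s = 0}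
  add_mem' hP hQ s hs := by simp [hP s hs, hQ s hs]
  zero_mem' _ _ := rfl
  smul_mem' q P hP s hs := by simp [hP s hs]

theorem depthFil_anti {m n : ℕ} (h : m ≤ n) : depthFil n ≤ depthFil m :=
  fun _ hP s hs => hP s (hs.trans_le h)

theorem mem_depthFil_zero (P : Mould) : P ∈ depthFil 0 := fun _ hs => absurd hs (by omega)

theorem mem_depthFil_one {P : Mould} : P ∈ depthFil 1 ↔ P 0 = 0 :=
  ⟨fun h => h 0 one_pos, fun h s hs => by obtain rfl : s = 0 := by omega
                                          exact h⟩

theorem eq_zero_of_mem_depthFil {P : Mould} (h : ∀ n, P ∈ depthFil n) : P = 0 :=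
  ext fun r => h (r + 1) r (by omega)

theorem eval_eq_zero_of_mem_depthFil {L : Type*} [Field L] [Algebra ℚ L] {n : ℕ} {P : Mould}
    (hP : P ∈ depthFil n) {w : List L} (hw : w.length < n) : P.eval w = 0 := by
  rw [eval_congr (Q := 0) (hP _ hw), eval_zero]

theorem mul_mem_depthFil {i j : ℕ} {P Q : Mould} (hP : P ∈ depthFil i) (hQ : Q ∈ depthFil j) :
    P * Q ∈ depthFil (i + j) := by
  intro r hr
  rw [mul_apply]
  refine Finset.sum_eq_zero fun k hk => ?_
  have hk := Finset.mem_range.1 hk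
  rcases lt_or_ge k i with h | h
  · rw [eval_eq_zero_of_mem_depthFil hP (by simp; omega), zero_mul]
  · rw [eval_eq_zero_of_mem_depthFil hQ (by simp; omega), mul_zero]

theorem lie_mem_depthFil {i j : ℕ} {P Q : Mould} (hP : P ∈ depthFil i) (hQ : Q ∈ depthFil j) :
    ⁅P, Q⁆ ∈ depthFil (i + j) :=
  sub_mem (mul_mem_depthFil hP hQ) (add_comm j i ▸ mul_mem_depthFil hQ hP)

theorem arit_mem_depthFil {i j : ℕ} {P Q : Mould} (hP : P ∈ depthFil i) (hQ : Q ∈ depthFil j) :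
    arit P Q ∈ depthFil (i + j) := by
  intro r hr
  refine Finset.sum_eq_zero fun l hl => Finset.sum_eq_zero fun k hk => ?_
  simp only [Finset.mem_range] at hk hl
  rcases lt_or_ge (l - k) i with h | h
  · dsimp only
    rw [eval_eq_zero_of_mem_depthFil hP (by simp; omega)]
    simp
  · dsimp only
    rw [eval_eq_zero_of_mem_depthFil hQ (by simp; omega),
      eval_eq_zero_of_mem_depthFil hQ (by simp; omega)]
    simp

theorem ari_mem_depthFil {i j : ℕ} {P Q : Mould} (hP : P ∈ depthFil i) (hQ : Q ∈ depthFil j) :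
    ari P Q ∈ depthFil (i + j) :=
  add_mem (sub_mem (add_comm j i ▸ arit_mem_depthFil hQ hP) (arit_mem_depthFil hP hQ))
    (lie_mem_depthFil hP hQ)

theorem dar_mem_depthFil {n : ℕ} {P : Mould} (hP : P ∈ depthFil n) : dar P ∈ depthFil n :=
  fun s hs => by simp [dar, hP s hs]

theorem darInv_mem_depthFil {n : ℕ} {P : Mould} (hP : P ∈ depthFil n) : darInv P ∈ depthFil n :=
  fun s hs => by simp [darInv, hP s hs]

theorem dur_mem_depthFil {n : ℕ} {P : Mould} (hP : P ∈ depthFil n) : dur P ∈ depthFil n :=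
  fun s hs => by simp [dur, hP s hs]

theorem Delta_mem_depthFil {n : ℕ} {P : Mould} (hP : P ∈ depthFil n) : Delta P ∈ depthFil n :=
  fun s hs => by simp [Delta, hP s hs]

theorem DeltaInv_mem_depthFil {n : ℕ} {P : Mould} (hP : P ∈ depthFil n) :
    DeltaInv P ∈ depthFil n :=
  fun s hs => by simp [DeltaInv, hP s hs]

theorem Darit_mem_depthFil {i j : ℕ} {P Q : Mould} (hP : P ∈ depthFil i) (hQ : Q ∈ depthFil j) :
    Darit P Q ∈ depthFil (i + j) :=
  neg_mem (dar_mem_depthFil (sub_mem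
    (arit_mem_depthFil (DeltaInv_mem_depthFil hP) (darInv_mem_depthFil hQ))
    (lie_mem_depthFil (DeltaInv_mem_depthFil hP) (darInv_mem_depthFil hQ))))

/-! ### The operators `dar`, `dur` and `Δ` -/

theorem prod_gen_ne_zero (r : ℕ) : (gen r).prod ≠ 0 := by
  rw [Ne, List.prod_eq_zero_iff, gen, List.mem_ofFn]
  rintro ⟨i, hi⟩
  exact MvPolynomial.X_ne_zero i ((map_eq_zero_iff _ (IsFractionRing.injective _ _)).1 hi)

theorem durFactor_ne_zero (r : ℕ) : durFactor r ≠ 0 := by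
  rw [durFactor]
  split_ifs with h
  · exact one_ne_zero
  · exact sum_gen_ne_zero h

@[simp] theorem dar_darInv (P : Mould) : dar (darInv P) = P :=
  ext fun r => mul_inv_cancel_left₀ (prod_gen_ne_zero r) _

@[simp] theorem darInv_dar (P : Mould) : darInv (dar P) = P :=
  ext fun r => inv_mul_cancel_left₀ (prod_gen_ne_zero r) _

@[simp] theorem Delta_DeltaInv (P : Mould) : Delta (DeltaInv P) = P :=
  ext fun r => mul_inv_cancel_left₀ (mul_ne_zero (prod_gen_ne_zero r) (durFactor_ne_zero r)) _

@[simp] theorem DeltaInv_Delta (P : Mould) : DeltaInv (Delta P) = P :=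
  ext fun r => inv_mul_cancel_left₀ (mul_ne_zero (prod_gen_ne_zero r) (durFactor_ne_zero r)) _

theorem Delta_eq (P : Mould) : Delta P = dar (dur P) := ext fun _ => mul_assoc _ _ _

theorem dar_add (P Q : Mould) : dar (P + Q) = dar P + dar Q := ext fun _ => mul_add _ _ _
theorem dar_sub (P Q : Mould) : dar (P - Q) = dar P - dar Q := ext fun _ => mul_sub _ _ _
theorem dar_neg (P : Mould) : dar (-P) = -dar P := ext fun _ => mul_neg _ _
theorem dar_smul (q : ℚ) (P : Mould) : dar (q • P) = q • dar P :=
  ext fun r => by simp [dar]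
theorem darInv_add (P Q : Mould) : darInv (P + Q) = darInv P + darInv Q :=
  ext fun _ => mul_add _ _ _
theorem darInv_smul (q : ℚ) (P : Mould) : darInv (q • P) = q • darInv P :=
  ext fun r => by simp [darInv]
theorem dur_add (P Q : Mould) : dur (P + Q) = dur P + dur Q := ext fun _ => mul_add _ _ _
theorem dur_sub (P Q : Mould) : dur (P - Q) = dur P - dur Q := ext fun _ => mul_sub _ _ _
theorem Delta_add (P Q : Mould) : Delta (P + Q) = Delta P + Delta Q := ext fun _ => mul_add _ _ _
theorem Delta_smul (q : ℚ) (P : Mould) : Delta (q • P) = q • Delta P :=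
  ext fun r => by simp [Delta]
theorem DeltaInv_add (P Q : Mould) : DeltaInv (P + Q) = DeltaInv P + DeltaInv Q :=
  ext fun _ => mul_add _ _ _
theorem DeltaInv_smul (q : ℚ) (P : Mould) : DeltaInv (q • P) = q • DeltaInv P :=
  ext fun r => by simp [DeltaInv]

theorem dur_dar (P : Mould) : dur (dar P) = dar (dur P) := ext fun _ => mul_left_comm _ _ _
theorem darInv_dur (P : Mould) : darInv (dur P) = dur (darInv P) :=
  ext fun _ => mul_left_comm _ _ _

theorem eval_dar {L : Type*} [Field L] [Algebra ℚ L] {w : List L} (hw : Indep w) (P : Mould) :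
    (dar P).eval w = w.prod * P.eval w := by
  rw [eval_eq_evalHom hw, eval_eq_evalHom hw, dar, map_mul, map_list_prod, map_gen]

theorem dar_mul (P Q : Mould) : dar (P * Q) = dar P * dar Q := by
  ext r
  rw [dar, mul_apply, mul_apply, Finset.mul_sum]
  refine Finset.sum_congr rfl fun i _ => ?_
  rw [eval_dar (indep_take r i), eval_dar (indep_drop r i)]
  have h : (gen r).prod = ((gen r).take i).prod * ((gen r).drop i).prod := by
    rw [← List.prod_append, List.take_append_drop]
  rw [h]
  ring

theorem dar_lie (P Q : Mould) : dar ⁅P, Q⁆ = ⁅dar P, dar Q⁆ := by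
  simp only [lie_def, dar_sub, dar_mul]

theorem darInv_mul (P Q : Mould) : darInv (P * Q) = darInv P * darInv Q := by
  rw [← darInv_dar (darInv P * darInv Q), dar_mul, dar_darInv, dar_darInv]

/-! ### The derivations `Darit` -/

theorem Darit_add (P X Y : Mould) : Darit P (X + Y) = Darit P X + Darit P Y := by
  simp only [Darit, darInv_add, arit_add, lie_add, dar_add, dar_sub]
  abel

theorem Darit_smul (P : Mould) (q : ℚ) (X : Mould) : Darit P (q • X) = q • Darit P X := by
  simp only [Darit, darInv_smul, arit_smul, lie_smul, ← smul_sub, dar_smul, smul_neg]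

theorem add_Darit (P Q X : Mould) : Darit (P + Q) X = Darit P X + Darit Q X := by
  simp only [Darit, DeltaInv_add, add_arit, add_lie, dar_add, dar_sub]
  abel

theorem smul_Darit (q : ℚ) (P X : Mould) : Darit (q • P) X = q • Darit P X := by
  simp only [Darit, DeltaInv_smul, smul_arit, smul_lie, ← smul_sub, dar_smul, smul_neg]

theorem Darit_mul (P X Y : Mould) : Darit P (X * Y) = Darit P X * Y + X * Darit P Y := by
  have h : Darit P X * Y + X * Darit P Y =
      dar (-(arit (DeltaInv P) (darInv X) - ⁅DeltaInv P, darInv X⁆) * darInv Y +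
        darInv X * -(arit (DeltaInv P) (darInv Y) - ⁅DeltaInv P, darInv Y⁆)) := by
    simp only [dar_add, dar_mul, dar_neg, dar_darInv, Darit]
  rw [h, Darit, darInv_mul, ← dar_neg, arit_mul]
  congr 1
  simp only [lie_def]
  noncomm_ring

theorem Darit_lie (P X Y : Mould) : Darit P ⁅X, Y⁆ = ⁅Darit P X, Y⁆ + ⁅X, Darit P Y⁆ := by
  have h : ∀ A B : Mould, Darit P (A - B) = Darit P A - Darit P B := fun A B => by
    rw [sub_eq_add_neg, Darit_add, ← neg_one_smul ℚ B, Darit_smul]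
    simp [sub_eq_add_neg]
  simp only [lie_def, h, Darit_mul]
  abel

theorem arit_lie (F X Y : Mould) : arit F ⁅X, Y⁆ = ⁅arit F X, Y⁆ + ⁅X, arit F Y⁆ := by
  have h : ∀ A B : Mould, arit F (A - B) = arit F A - arit F B :=
    fun A B => map_sub (aritLin F) A B
  simp only [lie_def, h, arit_mul]
  abel

theorem Darit_Delta_eq (F X : Mould) :
    Darit (Delta F) X = dar (⁅F, darInv X⁆ - arit F (darInv X)) := by
  rw [Darit, DeltaInv_Delta, ← dar_neg, neg_sub]

theorem arit_sub (F X Y : Mould) : arit F (X - Y) = arit F X - arit F Y :=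
  map_sub (aritLin F) X Y

/-- `Darit ∘ Δ` is a morphism for the bracket `ari`. -/
theorem Darit_comm (F G X : Mould) :
    Darit (Delta F) (Darit (Delta G) X) - Darit (Delta G) (Darit (Delta F) X) =
      Darit (Delta (ari F G)) X := by
  simp only [Darit_Delta_eq, darInv_dar, ← dar_sub]
  congr 1
  rw [arit_ari, ari]
  simp only [arit_sub, arit_lie, lie_sub, sub_lie, add_lie, lie_lie]
  abel

theorem dur_lie {X Y : Mould} (hX : X 0 = 0) (hY : Y 0 = 0) :
    dur ⁅X, Y⁆ = ⁅dur X, Y⁆ + ⁅X, dur Y⁆ := by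
  simp only [lie_def, dur_sub, dur_mul hX hY, dur_mul hY hX]
  abel

theorem Darit_Delta_comm {F G : Mould} (hF : F 0 = 0) (hG : G 0 = 0) :
    Darit (Delta F) (Delta G) - Darit (Delta G) (Delta F) = Delta (ari F G) := by
  rw [Darit_Delta_eq, Darit_Delta_eq, Delta_eq, Delta_eq, Delta_eq, darInv_dar, darInv_dar,
    ← dar_sub, arit_dur _ hF, arit_dur _ hG]
  congr 1
  rw [ari, dur_add, dur_sub, dur_lie hF hG, ← lie_skew (dur F) G]
  abel

theorem Darit_dur {P X : Mould} (hP : P 0 = 0) (hX : X 0 = 0) :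
    Darit P (dur X) = dur (Darit P X) + ⁅X, P⁆ := by
  obtain ⟨F, rfl⟩ : ∃ F, P = Delta F := ⟨DeltaInv P, (Delta_DeltaInv P).symm⟩
  have hF : F 0 = 0 := mem_depthFil_one.1
    (DeltaInv_Delta F ▸ DeltaInv_mem_depthFil (mem_depthFil_one.2 hP))
  have hY : darInv X 0 = 0 := by simp [darInv, hX]
  obtain ⟨Y, rfl⟩ : ∃ Y, X = dar Y := ⟨darInv X, (dar_darInv X).symm⟩
  rw [darInv_dar] at hY
  rw [Darit_Delta_eq, Darit_Delta_eq, darInv_dur, darInv_dar, arit_dur _ hY, dur_dar, Delta_eq,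
    ← dar_lie, ← dar_add, dur_sub, dur_lie hF hY, ← lie_skew (dur F) Y]
  congr 1
  abel

end Mould

/-! ### Exponentials in filtered modules -/

section FilteredExp

variable {V V₁ V₂ V₃ : Type*} [AddCommGroup V] [Module ℚ V] [AddCommGroup V₁] [Module ℚ V₁]
  [AddCommGroup V₂] [Module ℚ V₂] [AddCommGroup V₃] [Module ℚ V₃]

/-- The term of degree `k` of the exponential series of an operator. -/
def expTerm (T : V →ₗ[ℚ] V) (k : ℕ) (x : V) : V := (1 / (k.factorial : ℚ)) • (T^[k] x)

/-- The map `E` is the sum of the exponential series of `T` for the topology of a filtration. -/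
def IsFilteredExp (Fil : ℕ → Submodule ℚ V) (T : V →ₗ[ℚ] V) (E : V → V) : Prop :=
  ∀ n x, E x - ∑ k ∈ Finset.range n, expTerm T k x ∈ Fil n

theorem expTerm_zero (T : V →ₗ[ℚ] V) (x : V) : expTerm T 0 x = x := by simp [expTerm]

theorem expTerm_succ (T : V →ₗ[ℚ] V) (k : ℕ) (x : V) :
    ((k + 1 : ℕ) : ℚ) • expTerm T (k + 1) x = T (expTerm T k x) := by
  rw [expTerm, expTerm, map_smul, ← Function.iterate_succ_apply' T, smul_smul, Nat.factorial_succ]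
  congr 1
  push_cast
  field_simp

theorem expTerm_mem {Fil : ℕ → Submodule ℚ V} {T : V →ₗ[ℚ] V}
    (hT : ∀ n, ∀ x ∈ Fil n, T x ∈ Fil (n + 1)) {n : ℕ} {x : V} (hx : x ∈ Fil n) (k : ℕ) :
    expTerm T k x ∈ Fil (n + k) := by
  refine Submodule.smul_mem _ _ ?_
  induction k with
  | zero => exact hx
  | succ k ih => rw [Function.iterate_succ_apply']; exact hT _ _ ih

theorem expTerm_bilin {T₁ : V₁ →ₗ[ℚ] V₁} {T₂ : V₂ →ₗ[ℚ] V₂} {T₃ : V₃ →ₗ[ℚ] V₃}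
    {B : V₁ →ₗ[ℚ] V₂ →ₗ[ℚ] V₃} (hB : ∀ x y, T₃ (B x y) = B (T₁ x) y + B x (T₂ y))
    (x : V₁) (y : V₂) (k : ℕ) : expTerm T₃ k (B x y) =
      ∑ p ∈ Finset.HasAntidiagonal.antidiagonal k, B (expTerm T₁ p.1 x) (expTerm T₂ p.2 y) := by
  induction k with
  | zero => simp [expTerm_zero]
  | succ k ih =>
    have hk : ((k + 1 : ℕ) : ℚ) ≠ 0 := by positivity
    refine smul_right_injective _ hk ?_
    dsimp only
    rw [expTerm_succ, ih, map_sum]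
    simp only [hB, Finset.sum_add_distrib, ← expTerm_succ]
    have h1 : ∀ p ∈ Finset.HasAntidiagonal.antidiagonal (k + 1),
        ((k + 1 : ℕ) : ℚ) • B (expTerm T₁ p.1 x) (expTerm T₂ p.2 y) =
          (p.1 : ℚ) • B (expTerm T₁ p.1 x) (expTerm T₂ p.2 y) +
          (p.2 : ℚ) • B (expTerm T₁ p.1 x) (expTerm T₂ p.2 y) := by
      intro p hp
      rw [← Finset.HasAntidiagonal.mem_antidiagonal.1 hp, Nat.cast_add, add_smul]
    rw [Finset.smul_sum, Finset.sum_congr rfl h1, Finset.sum_add_distrib,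
      Finset.Nat.sum_antidiagonal_succ, Finset.Nat.sum_antidiagonal_succ']
    simp [map_smul]

theorem IsFilteredExp.bilin {F₁ : ℕ → Submodule ℚ V₁} {F₂ : ℕ → Submodule ℚ V₂}
    {F₃ : ℕ → Submodule ℚ V₃} {T₁ : V₁ →ₗ[ℚ] V₁} {T₂ : V₂ →ₗ[ℚ] V₂} {T₃ : V₃ →ₗ[ℚ] V₃}
    {E₁ : V₁ → V₁} {E₂ : V₂ → V₂} {E₃ : V₃ → V₃} (h₁ : IsFilteredExp F₁ T₁ E₁)
    (h₂ : IsFilteredExp F₂ T₂ E₂) (h₃ : IsFilteredExp F₃ T₃ E₃)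
    (hT₁ : ∀ n, ∀ x ∈ F₁ n, T₁ x ∈ F₁ (n + 1)) (hT₂ : ∀ n, ∀ x ∈ F₂ n, T₂ x ∈ F₂ (n + 1))
    (hF₁ : ∀ x, x ∈ F₁ 0) (hF₂ : ∀ x, x ∈ F₂ 0) (hF₃ : Antitone F₃)
    (hF₃' : ∀ x, (∀ n, x ∈ F₃ n) → x = 0) {B : V₁ →ₗ[ℚ] V₂ →ₗ[ℚ] V₃}
    (hBF : ∀ i j, ∀ x ∈ F₁ i, ∀ y ∈ F₂ j, B x y ∈ F₃ (i + j))
    (hB : ∀ x y, T₃ (B x y) = B (T₁ x) y + B x (T₂ y)) (x : V₁) (y : V₂) :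
    E₃ (B x y) = B (E₁ x) (E₂ y) := by
  rw [← sub_eq_zero]
  refine hF₃' _ fun n => ?_
  set a : ℕ → V₁ := fun k => expTerm T₁ k x
  set b : ℕ → V₂ := fun k => expTerm T₂ k y
  have ha : ∀ k, a k ∈ F₁ k := fun k => by simpa using expTerm_mem hT₁ (hF₁ x) k
  have hb : ∀ k, b k ∈ F₂ k := fun k => by simpa using expTerm_mem hT₂ (hF₂ y) k
  set Sa := ∑ k ∈ Finset.range n, a k with hSa
  set Sb := ∑ k ∈ Finset.range n, b k with hSb
  have e1 : B (E₁ x - Sa) (E₂ y) ∈ F₃ n := hBF n 0 _ (h₁ n x) _ (hF₂ _)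
  have e2 : B Sa (E₂ y - Sb) ∈ F₃ n := zero_add n ▸ hBF 0 n Sa (hF₁ Sa) _ (h₂ n y)
  have e3 := h₃ n (B x y)
  have e4 : B Sa Sb - ∑ k ∈ Finset.range n, expTerm T₃ k (B x y) ∈ F₃ n := by
    have h5 : B Sa Sb = ∑ p ∈ Finset.range n ×ˢ Finset.range n, B (a p.1) (b p.2) := by
      rw [hSa, hSb, Finset.sum_product, map_sum B, LinearMap.sum_apply]
      simp only [map_sum]
    have h6 : ∑ k ∈ Finset.range n, expTerm T₃ k (B x y) =
        ∑ p ∈ (Finset.range n ×ˢ Finset.range n) with p.1 + p.2 < n, B (a p.1) (b p.2) := by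
      rw [Finset.sum_congr rfl fun k _ => expTerm_bilin hB x y k, Finset.sum_sigma']
      refine Finset.sum_bij' (fun q _ => q.2) (fun p _ => ⟨p.1 + p.2, p⟩) ?_ ?_ ?_ ?_ ?_
      · rintro ⟨k, p⟩ h; simp at h ⊢; omega
      · rintro p h; simp at h ⊢; omega
      · rintro ⟨k, p⟩ h
        simp at h
        obtain ⟨_, rfl⟩ := h
        rfl
      · intro p _; rfl
      · intro p _; rfl
    rw [h5, h6, ← Finset.sum_filter_add_sum_filter_not _ (fun p : ℕ × ℕ => p.1 + p.2 < n),
      add_sub_cancel_left]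
    refine sum_mem fun p hp => ?_
    have : ¬ p.1 + p.2 < n := (Finset.mem_filter.1 hp).2
    exact hF₃ (by omega) (hBF _ _ _ (ha _) _ (hb _))
  have e5 : E₃ (B x y) - B (E₁ x) (E₂ y) =
      (E₃ (B x y) - ∑ k ∈ Finset.range n, expTerm T₃ k (B x y)) -
      (B Sa Sb - ∑ k ∈ Finset.range n, expTerm T₃ k (B x y)) -
      B Sa (E₂ y - Sb) - B (E₁ x - Sa) (E₂ y) := by
    simp only [map_sub, LinearMap.sub_apply]
    abel
  rw [e5]
  exact sub_mem (sub_mem (sub_mem e3 e4) e2) e1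

theorem IsFilteredExp.sub_mem {Fil : ℕ → Submodule ℚ V} {T : V →ₗ[ℚ] V} {E : V → V}
    (h : IsFilteredExp Fil T E) (hFil : Antitone Fil)
    (hT : ∀ n, ∀ x ∈ Fil n, T x ∈ Fil (n + 1)) {n : ℕ} {x : V} (hx : x ∈ Fil n) :
    E x - x ∈ Fil (n + 1) := by
  have h1 := h (n + 1) x
  rw [Finset.sum_range_succ', expTerm_zero] at h1
  have h2 : ∑ k ∈ Finset.range n, expTerm T (k + 1) x ∈ Fil (n + 1) :=
    sum_mem fun k _ => hFil (by omega) (expTerm_mem hT hx (k + 1))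
  have := add_mem h1 h2
  rwa [← sub_sub, sub_right_comm, sub_add_cancel] at this

end FilteredExp

namespace Mould

/-- The depth filtration of `ARI`. -/
noncomputable def ariFil (n : ℕ) : Submodule ℚ ARI := (depthFil n).comap ARI.toSubmodule.subtype

theorem mem_ariFil_zero (X : ARI) : X ∈ ariFil 0 := mem_depthFil_zero _

theorem mem_ariFil_one (X : ARI) : X ∈ ariFil 1 := mem_depthFil_one.2 X.2

theorem ariFil_anti : Antitone ariFil := fun _ _ h _ hX => depthFil_anti h hX

theorem eq_zero_of_mem_ariFil {X : ARI} (h : ∀ n, X ∈ ariFil n) : X = 0 :=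
  Subtype.ext (eq_zero_of_mem_depthFil h)

/-- The filtration of `ARI^a` by the depth, in which `a` has depth `0`. -/
noncomputable def ariaFil (n : ℕ) : Submodule ℚ ARIa where
  carrier := {Z | Z.left ∈ ariFil n ∧ (n ≠ 0 → Z.right = 0)}
  add_mem' hX hY := ⟨add_mem hX.1 hY.1, fun h => by
    exact (congrArg₂ (· + ·) (hX.2 h) (hY.2 h)).trans (add_zero 0)⟩
  zero_mem' := ⟨zero_mem _, fun _ => rfl⟩
  smul_mem' q X hX := ⟨Submodule.smul_mem _ _ hX.1, fun h => by
    exact (congrArg (q • ·) (hX.2 h)).trans (smul_zero q)⟩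

theorem mem_ariaFil_zero (Z : ARIa) : Z ∈ ariaFil 0 := ⟨mem_ariFil_zero _, fun h => absurd rfl h⟩

theorem ariaFil_anti : Antitone ariaFil := fun m n h Z hZ =>
  ⟨ariFil_anti h hZ.1, fun hm => hZ.2 (by omega)⟩

theorem eq_zero_of_mem_ariaFil {Z : ARIa} (h : ∀ n, Z ∈ ariaFil n) : Z = 0 :=
  LieAlgebra.SemiDirectSum.ext (eq_zero_of_mem_ariFil fun n => (h n).1) ((h 1).2 one_ne_zero)

/-! ### The derivations of `ARI` and of `ARI^a` -/

theorem Darit_mem (P : ARI) (X : ARI) : Darit P X ∈ ARI :=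
  mem_depthFil_one.1 (depthFil_anti (by omega)
    (Darit_mem_depthFil (mem_ariFil_one P) (mem_ariFil_one X)))

/-- `Darit(P)`, as an element of `ARI` that depends bilinearly on `P` and on the argument. -/
noncomputable def DaritLin : ARI →ₗ[ℚ] ARI →ₗ[ℚ] ARI :=
  LinearMap.mk₂ ℚ (fun P X => ⟨Darit P X, Darit_mem P X⟩)
    (fun P Q X => Subtype.ext (add_Darit P Q X)) (fun q P X => Subtype.ext (smul_Darit q P X))
    (fun P X Y => Subtype.ext (Darit_add P X Y)) (fun q P X => Subtype.ext (Darit_smul P q X))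

@[simp] theorem coe_DaritLin (P X : ARI) : (DaritLin P X : Mould) = Darit P X := rfl

/-- `Darit(P)`, as a derivation of `ARI`. -/
noncomputable def DaritDer (P : ARI) : LieDerivation ℚ ARI ARI where
  toLinearMap := DaritLin P
  leibniz' X Y := Subtype.ext <| by
    change Darit P ⁅X.1, Y.1⁆ = ⁅X.1, Darit P Y⁆ - ⁅Y.1, Darit P X⁆
    rw [Darit_lie, ← lie_skew (Darit P X)]
    abel

theorem coe_DaritDer (P X : ARI) : (DaritDer P X : Mould) = Darit P X := rfl

/-- The extension of `Darit(P)` to `ARI^a` with `a ↦ P`, which depends bilinearly on `P` and on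
the argument. -/
noncomputable def DaritaLin : ARI →ₗ[ℚ] ARIa →ₗ[ℚ] ARIa :=
  LinearMap.mk₂ ℚ (fun P Z => ⟨DaritLin P Z.left + Z.right • P, 0⟩)
    (fun P Q Z => by
      refine LieAlgebra.SemiDirectSum.ext ?_ (add_zero _).symm
      change DaritLin (P + Q) Z.left + Z.right • (P + Q) =
        (DaritLin P Z.left + Z.right • P) + (DaritLin Q Z.left + Z.right • Q)
      rw [map_add, LinearMap.add_apply, smul_add]
      abel)
    (fun q P Z => by
      refine LieAlgebra.SemiDirectSum.ext ?_ (smul_zero q).symm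
      change DaritLin (q • P) Z.left + Z.right • (q • P) = q • (DaritLin P Z.left + Z.right • P)
      rw [map_smul, LinearMap.smul_apply, smul_add, smul_comm])
    (fun P X Y => by
      refine LieAlgebra.SemiDirectSum.ext ?_ (add_zero _).symm
      change DaritLin P (X.left + Y.left) + (X.right + Y.right) • P =
        (DaritLin P X.left + X.right • P) + (DaritLin P Y.left + Y.right • P)
      rw [map_add, add_smul]
      abel)
    (fun q P X => by
      refine LieAlgebra.SemiDirectSum.ext ?_ (smul_zero q).symm
      change DaritLin P (q • X.left) + (q * X.right) • P = q • (DaritLin P X.left + X.right • P)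
      rw [map_smul, smul_add, mul_smul])

theorem DaritaLin_apply (P : ARI) (Z : ARIa) :
    DaritaLin P Z = ⟨DaritLin P Z.left + Z.right • P, 0⟩ := rfl

theorem aria_lie (X Y : ARIa) :
    ⁅X, Y⁆ = ⟨⁅X.left, Y.left⁆ - X.right • durDer Y.left + Y.right • durDer X.left, 0⟩ := by
  refine LieAlgebra.SemiDirectSum.ext ?_ ?_
  · change ⁅X.left, Y.left⁆ + -(X.right • durDer Y.left) - -(Y.right • durDer X.left) = _
    module
  · change X.right * Y.right - Y.right * X.right = 0
    ring

theorem DaritLin_dur (P X : ARI) :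
    DaritLin P (durDer X) = durDer (DaritLin P X) + ⁅X, P⁆ :=
  Subtype.ext (Darit_dur P.2 X.2)

theorem DaritLin_lie (P X Y : ARI) :
    DaritLin P ⁅X, Y⁆ = ⁅DaritLin P X, Y⁆ + ⁅X, DaritLin P Y⁆ :=
  Subtype.ext (Darit_lie P X Y)

theorem DaritaLin_lie (P : ARI) (X Y : ARIa) :
    DaritaLin P ⁅X, Y⁆ = ⁅DaritaLin P X, Y⁆ + ⁅X, DaritaLin P Y⁆ := by
  refine LieAlgebra.SemiDirectSum.ext ?_ ?_
  · rw [aria_lie, aria_lie, aria_lie, DaritaLin_apply, DaritaLin_apply, DaritaLin_apply]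
    change DaritLin P (⁅X.left, Y.left⁆ - X.right • durDer Y.left + Y.right • durDer X.left) +
      (0 : ℚ) • P = (⁅DaritLin P X.left + X.right • P, Y.left⁆ - (0 : ℚ) • durDer Y.left +
        Y.right • durDer (DaritLin P X.left + X.right • P)) +
      (⁅X.left, DaritLin P Y.left + Y.right • P⁆ -
        X.right • durDer (DaritLin P Y.left + Y.right • P) + (0 : ℚ) • durDer X.left)
    simp only [map_add, map_sub, map_smul, DaritLin_dur, DaritLin_lie, add_lie, lie_add, smul_lie,
      lie_smul, smul_add, zero_smul, ← lie_skew Y.left P, smul_neg, smul_comm Y.right X.right]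
    abel
  · rw [aria_lie, aria_lie, aria_lie]
    exact (add_zero (0 : ℚ)).symm

/-- The extension of `Darit(P)` to `ARI^a` with `a ↦ P`, as a derivation. -/
noncomputable def DaritaDer (P : ARI) : LieDerivation ℚ ARIa ARIa where
  toLinearMap := DaritaLin P
  leibniz' X Y := by
    rw [DaritaLin_lie, ← lie_skew Y]
    abel

theorem extendsDarit_DaritaDer (P : ARI) : ExtendsDarit P (DaritaDer P) := fun _ => ⟨rfl, rfl⟩

/-- `Δ`, as a linear operator on `ARI`. -/
noncomputable def DeltaLin : ARI →ₗ[ℚ] ARI where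
  toFun X := ⟨Delta X, mem_depthFil_one.1 (Delta_mem_depthFil (mem_ariFil_one X))⟩
  map_add' X Y := Subtype.ext (Delta_add X Y)
  map_smul' q X := Subtype.ext (Delta_smul q X)

theorem ari_add (L F G : Mould) : ari L (F + G) = ari L F + ari L G := by
  simp only [ari, add_arit, arit_add, lie_add]
  abel

theorem ari_smul (L : Mould) (q : ℚ) (F : Mould) : ari L (q • F) = q • ari L F := by
  simp only [ari, smul_arit, arit_smul, lie_smul, smul_add, smul_sub]

/-- `ad_ari(L)`, as a linear operator on `ARI`. -/
noncomputable def ariLin (L : ARI) : ARI →ₗ[ℚ] ARI where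
  toFun X := ⟨ari L X, mem_depthFil_one.1 (depthFil_anti (by omega)
    (ari_mem_depthFil (mem_ariFil_one L) (mem_ariFil_one X)))⟩
  map_add' X Y := Subtype.ext (ari_add L X Y)
  map_smul' q X := Subtype.ext (ari_smul L q X)

theorem DaritaLin_comm (L F : ARI) (Z : ARIa) :
    DaritaLin (DeltaLin L) (DaritaLin (DeltaLin F) Z) =
      DaritaLin (DeltaLin (ariLin L F)) Z +
        DaritaLin (DeltaLin F) (DaritaLin (DeltaLin L) Z) := by
  refine LieAlgebra.SemiDirectSum.ext ?_ (add_zero _).symm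
  change DaritLin (DeltaLin L) (DaritLin (DeltaLin F) Z.left + Z.right • DeltaLin F) +
      (0 : ℚ) • DeltaLin L =
    (DaritLin (DeltaLin (ariLin L F)) Z.left + Z.right • DeltaLin (ariLin L F)) +
    (DaritLin (DeltaLin F) (DaritLin (DeltaLin L) Z.left + Z.right • DeltaLin L) +
      (0 : ℚ) • DeltaLin F)
  have h1 : DaritLin (DeltaLin (ariLin L F)) Z.left =
      DaritLin (DeltaLin L) (DaritLin (DeltaLin F) Z.left) -
        DaritLin (DeltaLin F) (DaritLin (DeltaLin L) Z.left) :=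
    Subtype.ext (Darit_comm L F Z.left).symm
  have h2 : DeltaLin (ariLin L F) =
      DaritLin (DeltaLin L) (DeltaLin F) - DaritLin (DeltaLin F) (DeltaLin L) :=
    Subtype.ext (Darit_Delta_comm L.2 F.2).symm
  rw [h1, h2]
  simp only [map_add, map_smul, zero_smul, add_zero, smul_sub]
  abel

theorem DaritLin_mem_ariFil {i j : ℕ} {P X : ARI} (hP : P ∈ ariFil i) (hX : X ∈ ariFil j) :
    DaritLin P X ∈ ariFil (i + j) := Darit_mem_depthFil hP hX

theorem DaritaLin_mem_ariaFil {i j : ℕ} {P : ARI} {Z : ARIa} (hP : P ∈ ariFil i)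
    (hZ : Z ∈ ariaFil j) : DaritaLin P Z ∈ ariaFil (i + j) := by
  refine ⟨add_mem (DaritLin_mem_ariFil hP hZ.1) ?_, fun _ => rfl⟩
  rcases Nat.eq_zero_or_pos j with rfl | hj
  · exact Submodule.smul_mem _ _ hP
  · rw [hZ.2 hj.ne', zero_smul]
    exact zero_mem _

theorem aria_lie_mem_ariaFil {i j : ℕ} {X Y : ARIa} (hX : X ∈ ariaFil i) (hY : Y ∈ ariaFil j) :
    ⁅X, Y⁆ ∈ ariaFil (i + j) := by
  have h : ∀ {i j : ℕ} {X Y : ARIa}, X ∈ ariaFil i → Y ∈ ariaFil j →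
      X.right • durDer Y.left ∈ ariFil (i + j) := by
    intro i j X Y hX hY
    rcases Nat.eq_zero_or_pos i with rfl | hi
    · rw [zero_add]
      exact Submodule.smul_mem _ _ (dur_mem_depthFil hY.1)
    · rw [hX.2 hi.ne', zero_smul]
      exact zero_mem _
  rw [aria_lie]
  exact ⟨add_mem (sub_mem (lie_mem_depthFil hX.1 hY.1) (h hX hY)) (add_comm j i ▸ h hY hX),
    fun _ => rfl⟩

/-! ### Their exponentials -/

theorem coe_iterate {f : ARI →ₗ[ℚ] ARI} {T : Mould → Mould} (h : ∀ X : ARI, (f X : Mould) = T X)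
    (k : ℕ) (X : ARI) : ((f^[k] X : ARI) : Mould) = T^[k] X := by
  induction k with
  | zero => rfl
  | succ k ih => rw [Function.iterate_succ_apply', Function.iterate_succ_apply', h, ih]

theorem coe_sum_expTerm {f : ARI →ₗ[ℚ] ARI} {T : Mould → Mould}
    (h : ∀ X : ARI, (f X : Mould) = T X) (hf : ∀ n, ∀ X ∈ ariFil n, f X ∈ ariFil (n + 1))
    {n r : ℕ} (hr : r < n) (X : ARI) :
    ((∑ k ∈ Finset.range n, expTerm f k X : ARI) : Mould) r = expOp T X r := by
  have h1 : ∀ s : Finset ℕ, ((∑ k ∈ s, expTerm f k X : ARI) : Mould) r =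
      ∑ k ∈ s, (1 / (k.factorial : ℚ)) • (T^[k] X) r := by
    intro s
    induction s using Finset.induction_on with
    | empty => rfl
    | insert a s ha ih =>
      rw [Finset.sum_insert ha, Finset.sum_insert ha, ← ih, ← coe_iterate h]
      rfl
  rw [h1, expOp]
  symm
  refine Finset.sum_subset (Finset.range_subset_range.2 (by omega)) fun k _ hk => ?_
  rw [Finset.mem_range, not_lt] at hk
  have := expTerm_mem hf (mem_ariFil_zero X) k
  rw [← coe_iterate h]
  exact this r (by omega)

/-- The exponential of a linear operator on `ARI` that raises the depth. -/
noncomputable def expOpLin (f : ARI →ₗ[ℚ] ARI) : ARI →ₗ[ℚ] ARI where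
  toFun X := ⟨fun r => ((∑ k ∈ Finset.range (r + 1), expTerm f k X : ARI) : Mould) r,
    ((∑ k ∈ Finset.range (0 + 1), expTerm f k X : ARI)).2⟩
  map_add' X Y := by
    apply Subtype.ext
    funext r
    change _ = ((_ + _ : ARI) : Mould) r
    simp only [expTerm, ← Module.End.pow_apply, map_add, smul_add, Finset.sum_add_distrib]
    rfl
  map_smul' q X := by
    apply Subtype.ext
    funext r
    change _ = ((q • _ : ARI) : Mould) r
    simp only [expTerm, ← Module.End.pow_apply, map_smul, smul_comm _ q, ← Finset.smul_sum]
    rfl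

theorem coe_expOpLin {f : ARI →ₗ[ℚ] ARI} {T : Mould → Mould} (h : ∀ X : ARI, (f X : Mould) = T X)
    (hf : ∀ n, ∀ X ∈ ariFil n, f X ∈ ariFil (n + 1)) (X : ARI) :
    (expOpLin f X : Mould) = expOp T X :=
  ext fun r => coe_sum_expTerm h hf (Nat.lt_succ_self r) X

theorem isFilteredExp_expOpLin {f : ARI →ₗ[ℚ] ARI}
    (hf : ∀ n, ∀ X ∈ ariFil n, f X ∈ ariFil (n + 1)) : IsFilteredExp ariFil f (expOpLin f) := by
  intro n X r hr
  have hsub : Finset.range (r + 1) ⊆ Finset.range n := Finset.range_subset_range.2 (by omega)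
  have : (∑ k ∈ Finset.range n, expTerm f k X) - ∑ k ∈ Finset.range (r + 1), expTerm f k X
      ∈ ariFil (r + 1) := by
    rw [← Finset.sum_sdiff_eq_sub hsub]
    refine sum_mem fun k hk => ariFil_anti ?_ (expTerm_mem hf (mem_ariFil_zero X) k)
    simp at hk
    omega
  have := this r (by omega)
  change ((∑ k ∈ Finset.range (r + 1), expTerm f k X : ARI) : Mould) r -
    ((∑ k ∈ Finset.range n, expTerm f k X : ARI) : Mould) r = 0
  rw [← neg_sub, neg_eq_zero]
  exact this

theorem bijective_expOpLin {f : ARI →ₗ[ℚ] ARI}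
    (hf : ∀ n, ∀ X ∈ ariFil n, f X ∈ ariFil (n + 1)) : Function.Bijective (expOpLin f) := by
  have hsub : ∀ {n : ℕ} {X : ARI}, X ∈ ariFil n → expOpLin f X - X ∈ ariFil (n + 1) :=
    (isFilteredExp_expOpLin hf).sub_mem ariFil_anti hf
  constructor
  · refine (injective_iff_map_eq_zero _).2 fun X hX => eq_zero_of_mem_ariFil fun n => ?_
    induction n with
    | zero => exact mem_ariFil_zero X
    | succ n ih =>
      have := hsub ih
      rwa [hX, zero_sub, neg_mem_iff] at this
  · intro Y
    classical
    let Φ : Mould → Mould := fun X => if h : X ∈ ARI then expOpLin f ⟨X, h⟩ else X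
    have hΦ : ∀ X : ARI, Φ X = expOpLin f X := fun X => dif_pos X.2
    have hs : Φ (depthSolve Φ Y 0) = Y := by
      refine depthSolve_spec (fun X hX => ?_) fun X Z r hX hZ h => ?_
      · rw [hΦ ⟨X, hX⟩]
        exact (expOpLin f ⟨X, hX⟩).2.trans Y.2.symm
      · rw [hΦ ⟨X, hX⟩, hΦ ⟨Z, hZ⟩]
        have hXZ : (⟨X, hX⟩ - ⟨Z, hZ⟩ : ARI) ∈ ariFil r := fun s hs => sub_eq_zero.2 (h s hs)
        have := hsub hXZ
        rw [map_sub] at this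
        replace this := this r (Nat.lt_succ_self r)
        change ((expOpLin f ⟨X, hX⟩ : Mould) r - (expOpLin f ⟨Z, hZ⟩ : Mould) r) - (X r - Z r) = 0
          at this
        linear_combination this
    exact ⟨⟨depthSolve Φ Y 0, rfl⟩, Subtype.ext ((hΦ ⟨_, rfl⟩).symm.trans hs)⟩

theorem iterate_DaritLin_mem (P : ARI) (k : ℕ) : (DaritLin P)^[k] P ∈ ariFil (k + 1) := by
  induction k with
  | zero => exact mem_ariFil_one P
  | succ k ih =>
    rw [Function.iterate_succ_apply']
    exact ariFil_anti (by omega) (DaritLin_mem_ariFil (mem_ariFil_one P) ih)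

theorem DaritLin_raises (P : ARI) (n : ℕ) : ∀ X ∈ ariFil n, DaritLin P X ∈ ariFil (n + 1) :=
  fun _ hX => add_comm 1 n ▸ DaritLin_mem_ariFil (mem_ariFil_one P) hX

theorem DaritaLin_raises (P : ARI) (n : ℕ) : ∀ Z ∈ ariaFil n, DaritaLin P Z ∈ ariaFil (n + 1) :=
  fun _ hZ => add_comm 1 n ▸ DaritaLin_mem_ariaFil (mem_ariFil_one P) hZ

theorem ariLin_raises (L : ARI) (n : ℕ) : ∀ X ∈ ariFil n, ariLin L X ∈ ariFil (n + 1) :=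
  fun _ hX => add_comm 1 n ▸ ari_mem_depthFil (mem_ariFil_one L) hX

theorem coe_sum_ARI (s : Finset ℕ) (c : ℕ → ℚ) (g : ℕ → ARI) (r : ℕ) :
    ((∑ k ∈ s, c k • g k : ARI) : Mould) r = ∑ k ∈ s, c k • (g k : Mould) r := by
  induction s using Finset.induction_on with
  | empty => rfl
  | insert a s ha ih =>
    rw [Finset.sum_insert ha, Finset.sum_insert ha, ← ih]
    rfl

theorem expDari_zero_depth (P : Mould) : expDari P 0 = 1 := by
  simp [expDari, expSeries, one_apply]

/-- `exp_Dari(P) - 1`, as an element of `ARI`. -/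
noncomputable def expDariSubOne (P : ARI) : ARI :=
  ⟨expDari P - 1, by simp [mem_ARI, expDari_zero_depth, one_apply]⟩

theorem expDariSubOne_sub_mem (P : ARI) (n : ℕ) :
    expDariSubOne P - ∑ k ∈ Finset.range n,
      (1 / ((k + 1).factorial : ℚ)) • (DaritLin P)^[k] P ∈ ariFil (n + 1) := by
  intro r hr
  change ((expDari P - 1 : Mould) r) - ((∑ k ∈ Finset.range n,
      (1 / ((k + 1).factorial : ℚ)) • (DaritLin P)^[k] P : ARI) : Mould) r = 0
  rw [coe_sum_ARI, sub_apply, expDari, expSeries, add_sub_cancel_left, sub_eq_zero]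
  simp only [coe_iterate (coe_DaritLin P)]
  refine Finset.sum_subset (Finset.range_subset_range.2 (by omega)) fun k _ hk => ?_
  rw [Finset.mem_range, not_lt] at hk
  have h0 : (((DaritLin P)^[k] P : ARI) : Mould) r = 0 := iterate_DaritLin_mem P k r (by omega)
  rw [← coe_iterate (coe_DaritLin P), h0, smul_zero]

theorem expDari_injective {X Y : ARI} (h : expDari X = expDari Y) : X = Y := by
  rw [← sub_eq_zero]
  refine eq_zero_of_mem_ariFil fun n => ?_
  induction n with
  | zero => exact mem_ariFil_zero _
  | succ n ih =>
    have hk : ∀ k, (DaritLin X)^[k] X - (DaritLin Y)^[k] Y ∈ ariFil (n + k) := by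
      intro k
      induction k with
      | zero => exact ih
      | succ k ihk =>
        rw [Function.iterate_succ_apply', Function.iterate_succ_apply']
        have e : DaritLin X ((DaritLin X)^[k] X) - DaritLin Y ((DaritLin Y)^[k] Y) =
            DaritLin (X - Y) ((DaritLin X)^[k] X) +
              DaritLin Y ((DaritLin X)^[k] X - (DaritLin Y)^[k] Y) := by
          simp only [map_sub, LinearMap.sub_apply]
          abel
        rw [e]
        exact add_mem (DaritLin_mem_ariFil ih (iterate_DaritLin_mem X k))
          (DaritLin_raises Y _ _ ihk)
    rcases Nat.eq_zero_or_pos n with rfl | hn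
    · exact mem_ariFil_one _
    · have hXY : expDariSubOne X = expDariSubOne Y := Subtype.ext (by
        change expDari X - 1 = expDari Y - 1
        rw [h])
      have h1 := sub_mem (expDariSubOne_sub_mem Y n) (expDariSubOne_sub_mem X n)
      rw [hXY, sub_sub_sub_cancel_left, ← Finset.sum_sub_distrib] at h1
      obtain ⟨m, rfl⟩ := Nat.exists_eq_succ_of_ne_zero hn.ne'
      rw [Finset.sum_range_succ'] at h1
      have h2 : ∑ k ∈ Finset.range m, ((1 / ((k + 1 + 1).factorial : ℚ)) • (DaritLin X)^[k + 1] X -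
          (1 / ((k + 1 + 1).factorial : ℚ)) • (DaritLin Y)^[k + 1] Y) ∈ ariFil (m + 1 + 1) := by
        refine sum_mem fun k _ => ?_
        rw [← smul_sub]
        exact Submodule.smul_mem _ _ (ariFil_anti (by omega) (hk (k + 1)))
      have h3 := sub_mem h1 h2
      simpa using h3

theorem logDari_expDari (P : ARI) : logDari (expDari P) = P := by
  have h : expDari (logDari (expDari P)) = expDari P := expDari_logDari (expDari_zero_depth P)
  exact congrArg Subtype.val (expDari_injective (X := ⟨_, logDari_mem (expDari P)⟩) (Y := P) h)

/-- The exponential of the extension of `Darit(P)` to `ARI^a`. -/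
noncomputable def expDarita (P : ARI) : ARIa →ₗ[ℚ] ARIa where
  toFun Z := ⟨expOpLin (DaritLin P) Z.left + Z.right • expDariSubOne P, Z.right⟩
  map_add' X Y := by
    refine LieAlgebra.SemiDirectSum.ext ?_ rfl
    change expOpLin (DaritLin P) (X.left + Y.left) + (X.right + Y.right) • expDariSubOne P =
      (expOpLin (DaritLin P) X.left + X.right • expDariSubOne P) +
        (expOpLin (DaritLin P) Y.left + Y.right • expDariSubOne P)
    rw [map_add, add_smul]
    abel
  map_smul' q X := by
    refine LieAlgebra.SemiDirectSum.ext ?_ rfl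
    change expOpLin (DaritLin P) (q • X.left) + (q * X.right) • expDariSubOne P =
      q • (expOpLin (DaritLin P) X.left + X.right • expDariSubOne P)
    rw [map_smul, smul_add, mul_smul]

theorem expDarita_apply (P : ARI) (Z : ARIa) : expDarita P Z =
    ⟨expOpLin (DaritLin P) Z.left + Z.right • expDariSubOne P, Z.right⟩ := rfl

theorem bijective_expDarita (P : ARI) : Function.Bijective (expDarita P) := by
  have h := bijective_expOpLin (DaritLin_raises P)
  constructor
  · intro X Y hXY
    have hr : (expDarita P X).right = (expDarita P Y).right := by rw [hXY]
    change X.right = Y.right at hr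
    have hl : (expDarita P X).left = (expDarita P Y).left := by rw [hXY]
    change expOpLin (DaritLin P) X.left + X.right • expDariSubOne P =
      expOpLin (DaritLin P) Y.left + Y.right • expDariSubOne P at hl
    rw [hr, add_left_inj] at hl
    exact LieAlgebra.SemiDirectSum.ext (h.1 hl) hr
  · intro Z
    obtain ⟨X, hX⟩ := h.2 (Z.left - Z.right • expDariSubOne P)
    refine ⟨⟨X, Z.right⟩, LieAlgebra.SemiDirectSum.ext ?_ rfl⟩
    change expOpLin (DaritLin P) X + Z.right • expDariSubOne P = Z.left
    rw [hX, sub_add_cancel]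

theorem iterate_DaritaLin (P : ARI) (k : ℕ) (Z : ARIa) : (DaritaLin P)^[k + 1] Z =
    ⟨(DaritLin P)^[k + 1] Z.left + Z.right • (DaritLin P)^[k] P, 0⟩ := by
  induction k with
  | zero => rfl
  | succ k ih =>
    rw [Function.iterate_succ_apply', ih, DaritaLin_apply,
      Function.iterate_succ_apply' _ (k + 1), Function.iterate_succ_apply' _ k P]
    dsimp only
    rw [map_add, map_smul, zero_smul, add_zero]

theorem sum_expTerm_DaritaLin (P : ARI) (n : ℕ) (Z : ARIa) :
    ∑ k ∈ Finset.range n, expTerm (DaritaLin P) (k + 1) Z =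
      ⟨∑ k ∈ Finset.range n, expTerm (DaritLin P) (k + 1) Z.left + Z.right •
        ∑ k ∈ Finset.range n, (1 / ((k + 1).factorial : ℚ)) • (DaritLin P)^[k] P, 0⟩ := by
  induction n with
  | zero =>
    refine LieAlgebra.SemiDirectSum.ext ?_ rfl
    simp
  | succ n ih =>
    rw [Finset.sum_range_succ, ih, expTerm, iterate_DaritaLin]
    refine LieAlgebra.SemiDirectSum.ext ?_ ((zero_add _).trans (smul_zero _))
    rw [Finset.sum_range_succ, Finset.sum_range_succ, smul_add, expTerm]
    change (_ + _) + _ • (_ + _) = _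
    rw [smul_add, smul_comm Z.right, add_add_add_comm]

theorem isFilteredExp_expDarita (P : ARI) :
    IsFilteredExp ariaFil (DaritaLin P) (expDarita P) := by
  intro n Z
  rcases n with _ | n
  · exact mem_ariaFil_zero _
  · rw [Finset.sum_range_succ', expTerm_zero, sum_expTerm_DaritaLin, expDarita_apply]
    have h1 := isFilteredExp_expOpLin (DaritLin_raises P) (n + 1) Z.left
    rw [Finset.sum_range_succ', expTerm_zero] at h1
    have h2 := add_mem h1 (Submodule.smul_mem _ Z.right (expDariSubOne_sub_mem P n))
    refine ⟨?_, fun _ => ?_⟩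
    · convert h2 using 1
      change (_ + _) - ((_ + _) + _) = _
      rw [smul_sub]
      abel
    · change Z.right - (0 + Z.right) = 0
      ring

theorem expDarita_lie (P : ARI) (X Y : ARIa) :
    expDarita P ⁅X, Y⁆ = ⁅expDarita P X, expDarita P Y⁆ :=
  (isFilteredExp_expDarita P).bilin (isFilteredExp_expDarita P) (isFilteredExp_expDarita P)
    (DaritaLin_raises P) (DaritaLin_raises P) mem_ariaFil_zero mem_ariaFil_zero ariaFil_anti
    (fun _ => eq_zero_of_mem_ariaFil)
    (B := (LieModule.toEnd ℚ ARIa ARIa : ARIa →ₗ[ℚ] Module.End ℚ ARIa))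
    (fun _ _ _ hX _ hY => aria_lie_mem_ariaFil hX hY) (fun X Y => DaritaLin_lie P X Y) X Y

theorem DeltaLin_mem_ariFil {n : ℕ} {X : ARI} (hX : X ∈ ariFil n) : DeltaLin X ∈ ariFil n :=
  Delta_mem_depthFil hX

/-- Conjugation by the exponential of `Darit(Δ(L))` is the adjoint action of `exp_ari(L)`. -/
theorem expDarita_DaritaLin (L F : ARI) (Z : ARIa) :
    expDarita (DeltaLin L) (DaritaLin (DeltaLin F) Z) =
      DaritaLin (DeltaLin (expOpLin (ariLin L) F)) (expDarita (DeltaLin L) Z) := by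
  have hBF : ∀ i j, ∀ x ∈ ariFil i, ∀ y ∈ ariaFil j,
      (DaritaLin.comp DeltaLin) x y ∈ ariaFil (i + j) := fun i j x hx y hy => by
    rw [LinearMap.comp_apply]
    exact DaritaLin_mem_ariaFil (DeltaLin_mem_ariFil hx) hy
  have hB : ∀ (x : ARI) (y : ARIa), DaritaLin (DeltaLin L) ((DaritaLin.comp DeltaLin) x y) =
      (DaritaLin.comp DeltaLin) (ariLin L x) y +
        (DaritaLin.comp DeltaLin) x (DaritaLin (DeltaLin L) y) := fun x y => by
    simp only [LinearMap.comp_apply]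
    exact DaritaLin_comm L x y
  have h := (isFilteredExp_expOpLin (ariLin_raises L)).bilin (isFilteredExp_expDarita (DeltaLin L))
    (isFilteredExp_expDarita (DeltaLin L)) (ariLin_raises L) (DaritaLin_raises _) mem_ariFil_zero
    mem_ariaFil_zero ariaFil_anti (fun _ => eq_zero_of_mem_ariaFil) hBF hB F Z
  rwa [LinearMap.comp_apply, LinearMap.comp_apply] at h

/-- The automorphism of `ARI^a` that extends `Dgarit(exp_Dari(P))`. -/
noncomputable def expDaritaEquiv (P : ARI) : ARIa ≃ₗ⁅ℚ⁆ ARIa :=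
  LieEquiv.ofBijective { expDarita P with map_lie' := fun {X Y} => expDarita_lie P X Y }
    (bijective_expDarita P)

theorem expDaritaEquiv_apply (P : ARI) (Z : ARIa) : expDaritaEquiv P Z = expDarita P Z := rfl

theorem expDarita_inl (P X : ARI) :
    expDarita P ⟨X, 0⟩ = ⟨expOpLin (DaritLin P) X, 0⟩ := by
  rw [expDarita_apply, zero_smul, add_zero]

theorem expOpLin_DaritLin_lie (P X Y : ARI) : expOpLin (DaritLin P) ⁅X, Y⁆ =
    ⁅expOpLin (DaritLin P) X, expOpLin (DaritLin P) Y⁆ := by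
  have h := expDarita_lie P ⟨X, 0⟩ ⟨Y, 0⟩
  have hl : ∀ A B : ARI, (⁅(⟨A, 0⟩ : ARIa), (⟨B, 0⟩ : ARIa)⁆ : ARIa) = ⟨⁅A, B⁆, 0⟩ := fun A B => by
    rw [aria_lie, zero_smul, zero_smul, sub_zero, add_zero]
  rw [hl, expDarita_inl, expDarita_inl, expDarita_inl, hl] at h
  exact congrArg LieAlgebra.SemiDirectSum.left h

/-- The automorphism `Dgarit(exp_Dari(P))` of `ARI`. -/
noncomputable def expDaritEquiv (P : ARI) : ARI ≃ₗ⁅ℚ⁆ ARI :=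
  LieEquiv.ofBijective { expOpLin (DaritLin P) with
    map_lie' := fun {X Y} => expOpLin_DaritLin_lie P X Y } (bijective_expOpLin (DaritLin_raises P))

theorem expDaritEquiv_apply (P X : ARI) : expDaritEquiv P X = expOpLin (DaritLin P) X := rfl

theorem expOpLin_DaritLin_eq (L F X : ARI) :
    expOpLin (DaritLin (DeltaLin L)) (DaritLin (DeltaLin F) X) =
      DaritLin (DeltaLin (expOpLin (ariLin L) F)) (expOpLin (DaritLin (DeltaLin L)) X) := by
  have h := expDarita_DaritaLin L F ⟨X, 0⟩
  rw [expDarita_inl, DaritaLin_apply, DaritaLin_apply] at h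
  simp only [zero_smul, add_zero] at h
  rw [expDarita_inl] at h
  exact congrArg LieAlgebra.SemiDirectSum.left h

theorem coe_expOpLin_DaritLin (P X : ARI) :
    (expOpLin (DaritLin P) X : Mould) = Dgarit (expDari P) X := by
  rw [Dgarit, logDari_expDari, coe_expOpLin (coe_DaritLin P) (DaritLin_raises P)]

theorem coe_expDaritEquiv (P X : ARI) :
    (expDaritEquiv P X : Mould) = Dgarit (expDari P) X := by
  rw [expDaritEquiv_apply, coe_expOpLin_DaritLin]

theorem extendsDgarit_expDaritaEquiv (P : ARI) :
    ExtendsDgarit (expDari P) (expDaritaEquiv P) := fun Z => by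
  refine ⟨?_, rfl⟩
  rw [← coe_expOpLin_DaritLin]
  rfl

end Mould
end EcalleMould

open EcalleMould Mould
theorem proposition3p3p1 (F : Mould) (hF : F ∈ ARI) :
    (∃ (D D' : LieDerivation ℚ ARI ARI) (φ : ARI ≃ₗ⁅ℚ⁆ ARI),
      (∀ X : ARI, (D X : Mould) = Darit (Delta (Adari invpal F)) X) ∧
      (∀ X : ARI, (D' X : Mould) = Darit (Delta F) X) ∧
      (∀ X : ARI, (φ X : Mould) = Dgarit (Deltastar invpal) X) ∧
      ∀ X : ARI, D X = φ (D' (φ.symm X))) ∧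
    (∃ (D D' : LieDerivation ℚ ARIa ARIa) (φ : ARIa ≃ₗ⁅ℚ⁆ ARIa),
      ExtendsDarit (Delta (Adari invpal F)) D ∧
      ExtendsDarit (Delta F) D' ∧
      ExtendsDgarit (Deltastar invpal) φ ∧
      ∀ Z : ARIa, D Z = φ (D' (φ.symm Z))) := by
  let L : ARI := ⟨logari invpal, logari_mem invpal⟩
  let F' : ARI := ⟨F, hF⟩
  let G : ARI := expOpLin (ariLin L) F'
  have hG : (G : Mould) = Adari invpal F :=
    coe_expOpLin (T := ari L) (fun _ => rfl) (ariLin_raises L) F'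
  rw [← hG]
  have hL : Deltastar invpal = expDari (DeltaLin L) := rfl
  rw [hL]
  refine ⟨⟨DaritDer (DeltaLin G), DaritDer (DeltaLin F'), expDaritEquiv (DeltaLin L),
    coe_DaritDer _, coe_DaritDer _, coe_expDaritEquiv _, fun X => ?_⟩,
    ⟨DaritaDer (DeltaLin G), DaritaDer (DeltaLin F'), expDaritaEquiv (DeltaLin L),
    extendsDarit_DaritaDer _, extendsDarit_DaritaDer _, extendsDgarit_expDaritaEquiv _,
    fun Z => ?_⟩⟩
  · have h := expOpLin_DaritLin_eq L F' ((expDaritEquiv (DeltaLin L)).symm X)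
    rw [← expDaritEquiv_apply, ← expDaritEquiv_apply, LieEquiv.apply_symm_apply] at h
    exact h.symm
  · have h := expDarita_DaritaLin L F' ((expDaritaEquiv (DeltaLin L)).symm Z)
    rw [← expDaritaEquiv_apply, ← expDaritaEquiv_apply, LieEquiv.apply_symm_apply] at h
    exact h.symm
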